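/- Let $e_1,\dots,e_6$ be the standard orthonormal basis of Euclidean space $\mathbb R^6$ (identified with its dual), let $J$ be the complex structure $Je_{2i-1}=e_{2i}$, $Je_{2i}=-e_{2i-1}$, and let $\mathrm U(3)=\{A\in \mathrm{SO}(6): AJ=JA\}$. Let $\mathrm{SU}(3)\subset \mathrm U(3)$ be the subgroup of those elements which act on $\mathbb R^6=\mathbb C^3$, $z_j=x_{2j-1}+ix_{2j}$, by a special unitary matrix. Let $\Omega(X,Y)=\langle JX,Y\rangle$. Let $J$ act on forms by $(J\omega)(X,Y,\dots)=\omega(JX,JY,\dots)$, let $*$ be the Hodge operator on $\Lambda^3(\mathbb R^6)$ for the volume form $e_1\wedge\dots\wedge e_6$, let $\lrcorner$ denote the interior product, and put $\tau(T)=\sum_{i=1}^6(e_i\lrcorner\Omega)\wedge(e_i\lrcorner T)$ for $T\in\Lambda^3(\mathbb R^6)$. Define $$\Lambda^3_2=\{T:\tau^2(T)=-9T,\ J(T)=*T\},\qquad \Lambda^3_6=\{X\wedge\Omega: X\in\mathbb R^6\},\qquad \Lambda^3_{12}=\{T:\tau^2(T)=-T,\ J(T)=*T\}.$$ In $\Lambda^2(\mathbb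 R^6)=\mathfrak{so}(6)$ let $$\mathfrak{su}(3)=\{\omega: J(\omega)=\omega,\ \omega(e_1,e_2)+\omega(e_3,e_4)+\omega(e_5,e_6)=0\},\qquad \mathfrak m^6=\{\omega:J(\omega)=-\omega\},$$ and let $\mathrm{pr}_{\mathfrak m^6}:\Lambda^2(\mathbb R^6)\to\mathfrak m^6$ be the orthogonal projection. Define $\Phi:\mathbb R^6\otimes\mathfrak m^6\to\Lambda^3(\mathbb R^6)$ by $\Phi(X\otimes\omega)=X\wedge\omega$ and $\Theta:\Lambda^3(\mathbb R^6)\to\mathbb R^6\otimes\mathfrak m^6$ by $\Theta(T)=\sum_{i=1}^6 e_i\otimes\mathrm{pr}_{\mathfrak m^6}(e_i\lrcorner T)$, and put $$\mathcal W_1=\Theta(\Lambda^3_2),\quad \mathcal W_2=\operatorname{Ker}\Phi,\quad \mathcal W_3=\Theta(\Lambda^3_{12}),\quad \mathcal W_4=\Theta(\Lambda^3_6).$$ (1) $\Lambda^3(\mathbb R^6)=\Lambda^3_2\oplus\Lambda^3_6\oplus\Lambda^3_{12}$, and the summands are $\mathrm U(3)$-invariant, irreducible as real $\mathrm U(3)$-representations,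 and of real dimensions $2$, $6$ and $12$. They are identified by $J$, $*$ and $\tau$: $$\Lambda^3_2=\{T: J(T)=*T,\ \tau(T)=3{*}T\},\qquad \Lambda^3_6=\{T:J(T)=-{*}T\},\qquad \Lambda^3_{12}=\{T: J(T)=*T,\ \tau(T)=-{*}T\},$$ and $\tau(T)=*T$ on $\Lambda^3_6$. Moreover $\Lambda^3_6$ and $\Lambda^3_{12}$ are irreducible as real $\mathrm{SU}(3)$-representations, and $\mathrm{SU}(3)$ acts trivially on $\Lambda^3_2$. With respect to the complex structure given by $J$ on $\Lambda^3(\mathbb R^6)$, the spaces $\Lambda^3_2$, $\Lambda^3_6$, $\Lambda^3_{12}$ are irreducible complex representations, both of $\mathrm U(3)$ and of $\mathrm{SU}(3)$, of complex dimensions $1$, $3$ and $6$. (2) $\mathbb R^6\otimes\mathfrak m^6=\mathcal W_1\oplus\mathcal W_2\oplus\mathcal W_3\oplus\mathcal W_4$, and the summands are $\mathrm U(3)$-invariant, irreducible as real $\mathrm U(3)$-representations, and of real dimensions $2$, $16$, $12$ and $6$. In particular $\mathcal W_2$ is a real irreducible $\mathrm U(3)$-representation of dimension $16$. (3) As $\mathrm{SU}(3)$-representations,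 $\mathcal W_1$ is isomorphic to the trivial representation $\mathbb R^2$, $\mathcal W_2$ is isomorphic to $\mathfrak{su}(3)\oplus\mathfrak{su}(3)$ with $\mathfrak{su}(3)\subset\Lambda^2(\mathbb R^6)$ the adjoint representation, and hence $$\mathbb R^6\otimes\mathfrak m^6\cong\mathbb R^2\oplus\big(\mathfrak{su}(3)\oplus\mathfrak{su}(3)\big)\oplus\mathcal W_3\oplus\mathcal W_4.$$ -/

import Mathlib

open scoped TensorProduct InnerProductSpace

noncomputable section

namespace AlmostHermitian

/-- Euclidean space `ℝ⁶`. The orthonormal basis `e₁, …, e₆` is `e 0, …, e 5`. -/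
abbrev E6 : Type := EuclideanSpace ℝ (Fin 6)

/-- The standard orthonormal basis vectors. -/
def e (i : Fin 6) : E6 := EuclideanSpace.single i 1

/-- `Λᵏ(ℝ⁶)`: alternating `k`-forms on `ℝ⁶`. -/
abbrev Form (k : ℕ) : Type := E6 [⋀^Fin k]→ₗ[ℝ] ℝ

/-! ### The complex structure and the groups `U(3)`, `SU(3)` -/

/-- The complex structure: `J e₁ = e₂`, `J e₂ = -e₁`, and so on. -/
def J : E6 →ₗ[ℝ] E6 where
  toFun x := !₂[-x 1, x 0, -x 3, x 2, -x 5, x 4]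
  map_add' x y := by ext i; fin_cases i <;> simp [add_comm]
  map_smul' c x := by ext i; fin_cases i <;> simp

theorem J_J (x : E6) : J (J x) = -x := by
  ext i; fin_cases i <;> simp [J]

/-- `U(3) = {A ∈ SO(6) : A ∘ J = J ∘ A}`. -/
def U3 : Subgroup (E6 ≃ₗᵢ[ℝ] E6) where
  carrier := {A | LinearMap.det (A.toLinearEquiv : E6 →ₗ[ℝ] E6) = 1 ∧ ∀ x, A (J x) = J (A x)}
  one_mem' := ⟨LinearMap.det_id, fun _ => rfl⟩
  mul_mem' := by
    rintro A B ⟨hA, hA'⟩ ⟨hB, hB'⟩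
    refine ⟨?_, fun x => ?_⟩
    · have h : (((A * B : E6 ≃ₗᵢ[ℝ] E6).toLinearEquiv : E6 ≃ₗ[ℝ] E6) : E6 →ₗ[ℝ] E6)
          = (A.toLinearEquiv : E6 →ₗ[ℝ] E6) ∘ₗ (B.toLinearEquiv : E6 →ₗ[ℝ] E6) := rfl
      rw [h, LinearMap.det_comp, hA, hB, one_mul]
    · change A (B (J x)) = J (A (B x))
      rw [hB', hA']
  inv_mem' := by
    rintro A ⟨hA, hA'⟩
    refine ⟨?_, fun x => ?_⟩
    · have h : (A.toLinearEquiv : E6 →ₗ[ℝ] E6) ∘ₗ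
          (((A⁻¹ : E6 ≃ₗᵢ[ℝ] E6).toLinearEquiv : E6 ≃ₗ[ℝ] E6) : E6 →ₗ[ℝ] E6) = LinearMap.id :=
        LinearMap.ext fun x => A.apply_symm_apply x
      have h2 := congrArg LinearMap.det h
      rw [LinearMap.det_comp, hA, one_mul, LinearMap.det_id] at h2
      exact h2
    · apply A.injective
      rw [hA']
      exact (A.apply_symm_apply (J x)).trans (congrArg J (A.apply_symm_apply x).symm)

/-- The identification `ℝ⁶ = ℂ³`, `z_j = x_{2j-1} + i x_{2j}`, under which `J` is multiplication
by `i`. -/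
def toC3 (x : E6) : Fin 3 → ℂ := ![⟨x 0, x 1⟩, ⟨x 2, x 3⟩, ⟨x 4, x 5⟩]

theorem toC3_J (x : E6) : toC3 (J x) = Complex.I • toC3 x := by
  ext i; fin_cases i <;> simp [toC3, J, Complex.ext_iff]

/-- `SU(3) ⊂ U(3)`: the transformations which on `ℝ⁶ = ℂ³` are given by a special unitary
`3 × 3` matrix. -/
def SU3 : Subgroup U3 where
  carrier := {A | ∃ M ∈ Matrix.specialUnitaryGroup (Fin 3) ℂ,
    ∀ x : E6, toC3 (A.1 x) = M.mulVec (toC3 x)}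
  one_mem' := ⟨1, one_mem _, fun x => (Matrix.one_mulVec _).symm⟩
  mul_mem' := by
    rintro A B ⟨M, hM, hA⟩ ⟨N, hN, hB⟩
    refine ⟨M * N, mul_mem hM hN, fun x => ?_⟩
    rw [← Matrix.mulVec_mulVec, ← hB, ← hA]
    rfl
  inv_mem' := by
    rintro A ⟨M, hM, hA⟩
    refine ⟨star M, (star (⟨M, hM⟩ : Matrix.specialUnitaryGroup (Fin 3) ℂ)).2, fun x => ?_⟩
    have hx : A.1 ((A⁻¹ : U3).1 x) = x := A.1.apply_symm_apply x
    have h := hA ((A⁻¹ : U3).1 x)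
    rw [hx] at h
    rw [h, Matrix.mulVec_mulVec,
      (Matrix.mem_unitaryGroup_iff'.1 (Matrix.mem_specialUnitaryGroup_iff.1 hM).1),
      Matrix.one_mulVec]

/-! ### Exterior algebra -/

/-- The natural action of the isometries on `k`-forms,
`(A ω)(v₁, …, v_k) = ω(A⁻¹ v₁, …, A⁻¹ v_k)`. -/
def formRepO (k : ℕ) : Representation ℝ (E6 ≃ₗᵢ[ℝ] E6) (Form k) where
  toFun A :=
    { toFun := fun ω => ω.compLinearMap ((A⁻¹).toLinearEquiv : E6 →ₗ[ℝ] E6)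
      map_add' := fun _ _ => rfl
      map_smul' := fun _ _ => rfl }
  map_one' := rfl
  map_mul' _ _ := rfl

/-- The representation of `U(3)` on `Λᵏ(ℝ⁶)`. -/
def formRep (k : ℕ) : Representation ℝ U3 (Form k) := (formRepO k).comp U3.subtype

/-- The action of the complex structure on `k`-forms, `(J ω)(v₁, …, v_k) = ω(J v₁, …, J v_k)`. -/
def formJ (k : ℕ) : Form k →ₗ[ℝ] Form k where
  toFun ω := ω.compLinearMap J
  map_add' _ _ := rfl
  map_smul' _ _ := rfl

theorem formJ_formRep (k : ℕ) (A : U3) (ω : Form k) :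
    formJ k (formRep k A ω) = formRep k A (formJ k ω) := by
  ext v
  change ω (fun i => (A⁻¹ : U3).1 (J (v i))) = ω (fun i => J ((A⁻¹ : U3).1 (v i)))
  exact congrArg ω (funext fun i => (A⁻¹ : U3).2.2 (v i))

/-- The interior product `X ⌟ ω`, `(X ⌟ ω)(v₁, …, v_k) = ω(X, v₁, …, v_k)`. -/
def contract {k : ℕ} (X : E6) : Form (k + 1) →ₗ[ℝ] Form k where
  toFun ω := ω.curryLeft X
  map_add' _ _ := rfl
  map_smul' _ _ := rfl

/-- The exterior product `α ∧ ω` of a `1`-form and a `k`-form,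
`(α ∧ ω)(v₀, …, v_k) = ∑ᵢ (-1)ⁱ α(vᵢ) ω(v₀, …, v̂ᵢ, …, v_k)`. -/
def wedge {k : ℕ} : (E6 →ₗ[ℝ] ℝ) →ₗ[ℝ] Form k →ₗ[ℝ] Form (k + 1) :=
  LinearMap.mk₂ ℝ (fun α ω => AlternatingMap.alternatizeUncurryFin (α.smulRight ω))
    (fun α β ω => by ext v; simp [AlternatingMap.alternatizeUncurryFin_apply, add_mul,
      Finset.sum_add_distrib])
    (fun c α ω => by ext v; simp [AlternatingMap.alternatizeUncurryFin_apply, Finset.mul_sum,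
      mul_assoc, mul_left_comm])
    (fun α ω η => by ext v; simp [AlternatingMap.alternatizeUncurryFin_apply,
      Finset.sum_add_distrib])
    (fun c α ω => by ext v; simp [AlternatingMap.alternatizeUncurryFin_apply, Finset.mul_sum,
      mul_left_comm])

theorem wedge_apply {k : ℕ} (α : E6 →ₗ[ℝ] ℝ) (ω : Form k) (v : Fin (k + 1) → E6) :
    wedge α ω v = ∑ i : Fin (k + 1), (-1 : ℝ) ^ (i : ℕ) * (α (v i) * ω (i.removeNth v)) := by
  simp [wedge, AlternatingMap.alternatizeUncurryFin_apply]

/-- A `1`-form as a linear functional. -/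
def toFunctional (α : Form 1) : E6 →ₗ[ℝ] ℝ := (AlternatingMap.ofSubsingleton ℝ E6 ℝ 0).symm α

/-- The Kähler form `Ω(X, Y) = ⟨J X, Y⟩`. -/
def Ω : Form 2 where
  toFun v := ⟪J (v 0), v 1⟫_ℝ
  map_update_add' v i x y := by
    fin_cases i <;> simp [Function.update, inner_add_left, inner_add_right]
  map_update_smul' v i c x := by
    fin_cases i <;> simp [Function.update, inner_smul_left, inner_smul_right]
  map_eq_zero_of_eq' v i j h hij := by
    have h01 : v 0 = v 1 := by
      fin_cases i <;> fin_cases j <;> first | exact absurd rfl hij | exact h | exact h.symm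
    rw [h01]
    simp [J, PiLp.inner_apply, Fin.sum_univ_succ]
    ring

/-- The volume form `e₁ ∧ … ∧ e₆`. -/
def vol : Form 6 := (EuclideanSpace.basisFun (Fin 6) ℝ).toBasis.det

/-- The Hodge operator on `3`-forms: `*T = ∑_{i<j<k} T_{ijk} *e_{ijk}`, where
`*e_{ijk} = e_k ⌟ e_j ⌟ e_i ⌟ vol` is the `3`-form `vol(e_i, e_j, e_k, ·, ·, ·)`. -/
def hodge : Form 3 →ₗ[ℝ] Form 3 where
  toFun T := ∑ i, ∑ j, ∑ k, if i < j ∧ j < k then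
    T ![e i, e j, e k] • contract (e k) (contract (e j) (contract (e i) vol)) else 0
  map_add' S T := by
    simp only [← Finset.sum_add_distrib]
    refine Finset.sum_congr rfl fun i _ => Finset.sum_congr rfl fun j _ =>
      Finset.sum_congr rfl fun k _ => ?_
    split_ifs <;> simp [add_smul]
  map_smul' c T := by
    simp only [Finset.smul_sum]
    refine Finset.sum_congr rfl fun i _ => Finset.sum_congr rfl fun j _ =>
      Finset.sum_congr rfl fun k _ => ?_
    split_ifs <;> simp [mul_smul]

/-- The action `τ(T) = ∑ᵢ (eᵢ ⌟ Ω) ∧ (eᵢ ⌟ T)` of the central element `Ω ∈ u(3)` on `3`-forms. -/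
def τ : Form 3 →ₗ[ℝ] Form 3 :=
  ∑ i, wedge (toFunctional (contract (e i) Ω)) ∘ₗ contract (e i)

/-! ### Subspaces of forms -/

/-- `Λ³₂ = {T : τ²(T) = -9 T, J(T) = *T}`. -/
def Λ2 : Submodule ℝ (Form 3) where
  carrier := {T | τ (τ T) = (-9 : ℝ) • T ∧ formJ 3 T = hodge T}
  zero_mem' := by simp
  add_mem' := by rintro S T ⟨h1, h2⟩ ⟨h3, h4⟩; simp only [Set.mem_ofPred_eq, map_add, smul_add, *, and_self]
  smul_mem' := by rintro c T ⟨h1, h2⟩; simp only [Set.mem_ofPred_eq, map_smul, h1, h2, smul_comm c, and_self]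

/-- `Λ³₆ = {X ∧ Ω : X ∈ ℝ⁶}`, a vector `X` being identified with the `1`-form `⟨X, ·⟩`. -/
def Λ6 : Submodule ℝ (Form 3) := LinearMap.range (wedge.flip Ω ∘ₗ innerₗ E6)

/-- `Λ³₁₂ = {T : τ²(T) = -T, J(T) = *T}`. -/
def Λ12 : Submodule ℝ (Form 3) where
  carrier := {T | τ (τ T) = -T ∧ formJ 3 T = hodge T}
  zero_mem' := by simp
  add_mem' := by rintro S T ⟨h1, h2⟩ ⟨h3, h4⟩; simp only [Set.mem_ofPred_eq, map_add, neg_add, *, and_self]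
  smul_mem' := by rintro c T ⟨h1, h2⟩; simp only [Set.mem_ofPred_eq, map_smul, h1, h2, smul_neg, and_self]

/-- `su(3) ⊂ u(3) = {ω ∈ Λ²(ℝ⁶) : J(ω) = ω}`, the subspace cut out by `w₁₂ + w₃₄ + w₅₆ = 0`. -/
def su3 : Submodule ℝ (Form 2) where
  carrier := {ω | formJ 2 ω = ω ∧ ω ![e 0, e 1] + ω ![e 2, e 3] + ω ![e 4, e 5] = 0}
  zero_mem' := by simp
  add_mem' := by
    rintro ω η ⟨h1, h2⟩ ⟨h3, h4⟩
    refine ⟨by rw [map_add, h1, h3], ?_⟩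
    simp only [AlternatingMap.add_apply]
    linarith
  smul_mem' := by
    rintro c ω ⟨h1, h2⟩
    refine ⟨by rw [map_smul, h1], ?_⟩
    simp only [AlternatingMap.smul_apply, smul_eq_mul, ← mul_add, h2, mul_zero]

/-- `𝔪 = {ω ∈ Λ²(ℝ⁶) : J(ω) = -ω}`, the complement of `u(3)` in `so(6) = Λ²(ℝ⁶)`, as a
`U(3)`-representation. -/
def mSub : Subrepresentation (formRep 2) where
  toSubmodule := LinearMap.ker (formJ 2 + LinearMap.id)
  apply_mem_toSubmodule A ω h := by
    simp only [LinearMap.mem_ker, LinearMap.add_apply, LinearMap.id_apply] at h ⊢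
    rw [formJ_formRep, ← map_add, h, map_zero]

/-- The underlying vector space of `𝔪`. -/
abbrev M6 : Type := mSub.toSubmodule

theorem formJ_formJ_two (ω : Form 2) : formJ 2 (formJ 2 ω) = ω := by
  ext v
  have h : (fun i => J (J (v i))) = fun i => (-1 : ℝ) • v i := by
    funext i; rw [J_J, neg_one_smul]
  change ω (fun i => J (J (v i))) = ω v
  rw [h, AlternatingMap.map_smul_univ]
  simp

/-- The orthogonal projection `so(6) = u(3) ⊕ 𝔪 → 𝔪`. As `u(3)` and `𝔪` are the eigenspaces of
the isometric involution `J` of `Λ²(ℝ⁶)`, it is `ω ↦ (ω - J ω) / 2`. -/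
def prM : Form 2 →ₗ[ℝ] M6 :=
  LinearMap.codRestrict mSub.toSubmodule ((1 / 2 : ℝ) • (LinearMap.id - formJ 2)) fun ω => by
    rw [mSub, LinearMap.mem_ker]
    simp [formJ_formJ_two]

/-! ### The representation `ℝ⁶ ⊗ 𝔪` -/

/-- The standard representation of `U(3)` on `ℝ⁶`. -/
def stdRep : Representation ℝ U3 E6 where
  toFun A := (A.1.toLinearEquiv : E6 →ₗ[ℝ] E6)
  map_one' := rfl
  map_mul' _ _ := rfl

/-- The representation of `U(3)` on `ℝ⁶ ⊗ 𝔪`. -/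
def tensorRep : Representation ℝ U3 (E6 ⊗[ℝ] M6) := stdRep.tprod mSub.toRepresentation

/-- `Φ(X ⊗ ω) = X ∧ ω`. -/
def Φ : E6 ⊗[ℝ] M6 →ₗ[ℝ] Form 3 :=
  TensorProduct.lift ((wedge ∘ₗ innerₗ E6).compl₂ mSub.toSubmodule.subtype)

/-- `Θ(T) = ∑ᵢ eᵢ ⊗ pr_𝔪(eᵢ ⌟ T)`. -/
def Θ : Form 3 →ₗ[ℝ] E6 ⊗[ℝ] M6 :=
  ∑ i, TensorProduct.mk ℝ E6 M6 (e i) ∘ₗ prM ∘ₗ contract (e i)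

/-- `𝒲₁ = Θ(Λ³₂)`. -/
def W1 : Submodule ℝ (E6 ⊗[ℝ] M6) := Λ2.map Θ

/-- `𝒲₂ = Ker Φ`. -/
def W2 : Submodule ℝ (E6 ⊗[ℝ] M6) := LinearMap.ker Φ

/-- `𝒲₃ = Θ(Λ³₁₂)`. -/
def W3 : Submodule ℝ (E6 ⊗[ℝ] M6) := Λ12.map Θ

/-- `𝒲₄ = Θ(Λ³₆)`. -/
def W4 : Submodule ℝ (E6 ⊗[ℝ] M6) := Λ6.map Θ

/-! ### Representation theory -/

/-- The restriction to `SU(3)` of a representation of `U(3)`. -/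
def resSU3 {F V : Type} [Field F] [AddCommGroup V] [Module F V] (ρ : Representation F U3 V) :
    Representation F SU3 V := ρ.comp SU3.subtype

/-- The subspace `W` is invariant under `ρ`, and irreducible as a representation. -/
def IsIrreducibleOn {F G V : Type} [Field F] [Group G] [AddCommGroup V] [Module F V]
    (ρ : Representation F G V) (W : Submodule F V) : Prop :=
  ∃ S : Subrepresentation ρ, S.toSubmodule = W ∧ S.toRepresentation.IsIrreducible

/-- `Λ³(ℝ⁶)` as a complex vector space: multiplication by `i` is the operator `J` on `3`-forms. -/
def ComplexForm3 : Type := Form 3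

instance : AddCommGroup ComplexForm3 := inferInstanceAs (AddCommGroup (Form 3))

theorem formJ_mul_formJ_three : formJ 3 * formJ 3 = (-1 : Module.End ℝ (Form 3)) := by
  ext T v
  have h : (fun i => J (J (v i))) = fun i => (-1 : ℝ) • v i := by
    funext i; rw [J_J, neg_one_smul]
  change T (fun i => J (J (v i))) = -(T v)
  rw [h, AlternatingMap.map_smul_univ]
  norm_num

/-- The ring homomorphism `a + b i ↦ a + b J`. -/
def complexAction : ℂ →ₐ[ℝ] Module.End ℝ (Form 3) :=
  Complex.lift ⟨formJ 3, formJ_mul_formJ_three⟩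

instance : Module ℂ ComplexForm3 :=
  Module.compHom (Form 3) complexAction.toRingHom

/-- The identity map, viewing a `3`-form as a vector of the complex vector space. -/
def toComplexForm3 : Form 3 ≃+ ComplexForm3 := AddEquiv.refl (Form 3)

theorem complex_smul_def (z : ℂ) (T : Form 3) :
    z • toComplexForm3 T = toComplexForm3 (z.re • T + z.im • formJ 3 T) := by
  change complexAction z T = z.re • T + z.im • formJ 3 T
  simp [complexAction, Complex.liftAux_apply, Algebra.algebraMap_eq_smul_one]

/-- The representation of `U(3)` on `Λ³(ℝ⁶)` as a complex representation. -/
def complexFormRep : Representation ℂ U3 ComplexForm3 where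
  toFun A :=
    { toFun := fun T => toComplexForm3 (formRep 3 A (toComplexForm3.symm T))
      map_add' := fun S T => (formRep 3 A).map_add S T
      map_smul' := fun z T => by
        obtain ⟨T, rfl⟩ := toComplexForm3.surjective T
        rw [complex_smul_def]
        simp [complex_smul_def, formJ_formRep] }
  map_one' := rfl
  map_mul' _ _ := rfl

/-- The subspace `W` of `Λ³(ℝ⁶)` is a complex, invariant subspace for the complex representation
`ρ`, irreducible as a complex representation and of complex dimension `d`. -/
def IsComplexIrreducibleOn {G : Type} [Group G] (ρ : Representation ℂ G ComplexForm3)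
    (W : Submodule ℝ (Form 3)) (d : ℕ) : Prop :=
  ∃ S : Submodule ℂ ComplexForm3, (∀ T : Form 3, toComplexForm3 T ∈ S ↔ T ∈ W) ∧
    IsIrreducibleOn ρ S ∧ Module.finrank ℂ S = d

end AlmostHermitian

end

open AlmostHermitian

noncomputable section

namespace AlmostHermitian

/-! ### Forms evaluated on vectors -/

theorem form_two_eta (ω : Form 2) (v : Fin 2 → E6) : ω v = ω ![v 0, v 1] :=
  congrArg ω (funext fun i => by fin_cases i <;> rfl)

theorem form_three_eta (T : Form 3) (v : Fin 3 → E6) : T v = T ![v 0, v 1, v 2] :=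
  congrArg T (funext fun i => by fin_cases i <;> rfl)

theorem form_two_ext {S T : Form 2} (h : ∀ u v, S ![u, v] = T ![u, v]) : S = T := by
  ext v; rw [form_two_eta, form_two_eta T, h]

theorem form_three_ext {S T : Form 3} (h : ∀ u v w, S ![u, v, w] = T ![u, v, w]) : S = T := by
  ext v; rw [form_three_eta, form_three_eta T, h]

theorem contract_apply_two (X : E6) (T : Form 3) (u v : E6) :
    contract X T ![u, v] = T ![X, u, v] := rfl

theorem contract_apply_one (X : E6) (ω : Form 2) (v : E6) :
    contract X ω ![v] = ω ![X, v] := rfl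

theorem form_three_swap01 (T : Form 3) (u v w : E6) : T ![u, v, w] = -T ![v, u, w] := by
  rw [← T.map_swap ![v, u, w] (show (0 : Fin 3) ≠ 1 by decide)]
  exact congrArg T (funext fun i => by fin_cases i <;> rfl)

theorem form_three_swap12 (T : Form 3) (u v w : E6) : T ![u, v, w] = -T ![u, w, v] := by
  rw [← T.map_swap ![u, w, v] (show (1 : Fin 3) ≠ 2 by decide)]
  exact congrArg T (funext fun i => by fin_cases i <;> rfl)

theorem form_three_rot (T : Form 3) (u v w : E6) : T ![u, v, w] = T ![v, w, u] := by
  rw [form_three_swap01, form_three_swap12, neg_neg]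

theorem form_two_swap (ω : Form 2) (u v : E6) : ω ![u, v] = -ω ![v, u] := by
  rw [← ω.map_swap ![v, u] (show (0 : Fin 2) ≠ 1 by decide)]
  exact congrArg ω (funext fun i => by fin_cases i <;> rfl)

theorem form_three_self01 (T : Form 3) (u w : E6) : T ![u, u, w] = 0 := by
  have := form_three_swap01 T u u w; linarith

theorem form_three_self12 (T : Form 3) (u w : E6) : T ![w, u, u] = 0 := by
  have := form_three_swap12 T w u u; linarith

theorem form_three_self02 (T : Form 3) (u w : E6) : T ![u, w, u] = 0 := by
  rw [form_three_swap12, form_three_self01, neg_zero]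

theorem form_two_self (ω : Form 2) (u : E6) : ω ![u, u] = 0 := by
  have := form_two_swap ω u u; linarith

theorem form_sum_apply {ι : Type*} {k : ℕ} (s : Finset ι) (f : ι → Form k) (v : Fin k → E6) :
    (∑ i ∈ s, f i) v = ∑ i ∈ s, f i v :=
  map_sum (AddMonoidHom.mk' (fun T : Form k => T v) fun _ _ => rfl) f s

/-- Contraction as a linear map in the vector. -/
def contractₗ {k : ℕ} (T : Form (k + 1)) : E6 →ₗ[ℝ] Form k := T.curryLeft

theorem contractₗ_apply {k : ℕ} (T : Form (k + 1)) (X : E6) : contractₗ T X = contract X T := rfl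

theorem contract_add {k : ℕ} (X Y : E6) (T : Form (k + 1)) :
    contract (X + Y) T = contract X T + contract Y T := (contractₗ T).map_add X Y

theorem contract_smul {k : ℕ} (c : ℝ) (X : E6) (T : Form (k + 1)) :
    contract (c • X) T = c • contract X T := (contractₗ T).map_smul c X

theorem contract_neg {k : ℕ} (X : E6) (T : Form (k + 1)) :
    contract (-X) T = -contract X T := (contractₗ T).map_neg X

theorem form_three_add0 (T : Form 3) (a b v w : E6) :
    T ![a + b, v, w] = T ![a, v, w] + T ![b, v, w] := by
  rw [← contract_apply_two, contract_add]; rfl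

theorem form_three_smul0 (T : Form 3) (c : ℝ) (a v w : E6) :
    T ![c • a, v, w] = c * T ![a, v, w] := by
  rw [← contract_apply_two, contract_smul]; rfl

theorem form_three_neg0 (T : Form 3) (a v w : E6) : T ![-a, v, w] = -T ![a, v, w] := by
  rw [← contract_apply_two, contract_neg]; rfl

theorem form_three_add1 (T : Form 3) (u a b w : E6) :
    T ![u, a + b, w] = T ![u, a, w] + T ![u, b, w] := by
  rw [form_three_swap01, form_three_add0, form_three_swap01 T u a, form_three_swap01 T u b]; ring

theorem form_three_smul1 (T : Form 3) (c : ℝ) (u a w : E6) :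
    T ![u, c • a, w] = c * T ![u, a, w] := by
  rw [form_three_swap01, form_three_smul0, form_three_swap01 T u a]; ring

theorem form_three_neg1 (T : Form 3) (u a w : E6) : T ![u, -a, w] = -T ![u, a, w] := by
  rw [form_three_swap01, form_three_neg0, form_three_swap01 T u a]

theorem form_three_add2 (T : Form 3) (u v a b : E6) :
    T ![u, v, a + b] = T ![u, v, a] + T ![u, v, b] := by
  rw [form_three_swap12, form_three_add1, form_three_swap12 T u v a, form_three_swap12 T u v b]
  ring

theorem form_three_smul2 (T : Form 3) (c : ℝ) (u v a : E6) :
    T ![u, v, c • a] = c * T ![u, v, a] := by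
  rw [form_three_swap12, form_three_smul1, form_three_swap12 T u v a]; ring

theorem form_three_neg2 (T : Form 3) (u v a : E6) : T ![u, v, -a] = -T ![u, v, a] := by
  rw [form_three_swap12, form_three_neg1, form_three_swap12 T u v a]

theorem form_two_add0 (ω : Form 2) (a b v : E6) :
    ω ![a + b, v] = ω ![a, v] + ω ![b, v] := by
  rw [← contract_apply_one, contract_add]; rfl

theorem form_two_smul0 (ω : Form 2) (c : ℝ) (a v : E6) : ω ![c • a, v] = c * ω ![a, v] := by
  rw [← contract_apply_one, contract_smul]; rfl

theorem form_two_neg0 (ω : Form 2) (a v : E6) : ω ![-a, v] = -ω ![a, v] := by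
  rw [← contract_apply_one, contract_neg]; rfl

theorem form_two_add1 (ω : Form 2) (a b v : E6) :
    ω ![v, a + b] = ω ![v, a] + ω ![v, b] := by
  rw [form_two_swap, form_two_add0, form_two_swap ω v a, form_two_swap ω v b]; ring

theorem form_two_smul1 (ω : Form 2) (c : ℝ) (a v : E6) : ω ![v, c • a] = c * ω ![v, a] := by
  rw [form_two_swap, form_two_smul0, form_two_swap ω v a]; ring

theorem form_two_neg1 (ω : Form 2) (a v : E6) : ω ![v, -a] = -ω ![v, a] := by
  rw [form_two_swap, form_two_neg0, form_two_swap ω v a]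

theorem wedge_apply_three (α : E6 →ₗ[ℝ] ℝ) (ω : Form 2) (u v w : E6) :
    wedge α ω ![u, v, w] = α u * ω ![v, w] - α v * ω ![u, w] + α w * ω ![u, v] := by
  have h0 : (0 : Fin 3).removeNth ![u, v, w] = ![v, w] := by
    funext i; fin_cases i <;> rfl
  have h1 : (1 : Fin 3).removeNth ![u, v, w] = ![u, w] := by
    funext i; fin_cases i <;> rfl
  have h2 : (2 : Fin 3).removeNth ![u, v, w] = ![u, v] := by
    funext i; fin_cases i <;> rfl
  rw [wedge_apply, Fin.sum_univ_three, h0, h1, h2]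
  simp
  ring

theorem formJ_apply_two (ω : Form 2) (u v : E6) : formJ 2 ω ![u, v] = ω ![J u, J v] := by
  change ω (fun i => J (![u, v] i)) = _
  rw [form_two_eta]; rfl

theorem formJ_apply_three (T : Form 3) (u v w : E6) :
    formJ 3 T ![u, v, w] = T ![J u, J v, J w] := by
  change T (fun i => J (![u, v, w] i)) = _
  rw [form_three_eta]; rfl

theorem formRep_apply_two (A : U3) (ω : Form 2) (u v : E6) :
    formRep 2 A ω ![u, v] = ω ![(A⁻¹).1 u, (A⁻¹).1 v] := by
  change ω (fun i => (A⁻¹).1 (![u, v] i)) = _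
  rw [form_two_eta]; rfl

theorem formRep_apply_three (A : U3) (T : Form 3) (u v w : E6) :
    formRep 3 A T ![u, v, w] = T ![(A⁻¹).1 u, (A⁻¹).1 v, (A⁻¹).1 w] := by
  change T (fun i => (A⁻¹).1 (![u, v, w] i)) = _
  rw [form_three_eta]; rfl

theorem U3_apply_inv (A : U3) (x : E6) : A.1 ((A⁻¹).1 x) = x := A.1.apply_symm_apply x

theorem U3_inv_apply (A : U3) (x : E6) : (A⁻¹).1 (A.1 x) = x := A.1.symm_apply_apply x

theorem U3_comm_J (A : U3) (x : E6) : A.1 (J x) = J (A.1 x) := A.2.2 x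

theorem U3_inner (A : U3) (x y : E6) : ⟪A.1 x, A.1 y⟫_ℝ = ⟪x, y⟫_ℝ := A.1.inner_map_map x y

theorem formRep_contract (A : U3) (T : Form 3) (X : E6) :
    formRep 2 A (contract X T) = contract (A.1 X) (formRep 3 A T) := by
  refine form_two_ext fun u v => ?_
  rw [formRep_apply_two, contract_apply_two, contract_apply_two, formRep_apply_three, U3_inv_apply]

/-! ### The standard basis -/

theorem e_apply (i j : Fin 6) : e i j = if j = i then 1 else 0 := by
  simp [e]

theorem inner_e_left (i : Fin 6) (x : E6) : ⟪e i, x⟫_ℝ = x i := by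
  simp [e, EuclideanSpace.inner_single_left]

theorem inner_e_right (i : Fin 6) (x : E6) : ⟪x, e i⟫_ℝ = x i := by
  rw [real_inner_comm, inner_e_left]

theorem sum_inner_smul_e (x : E6) : ∑ i, ⟪e i, x⟫_ℝ • e i = x := by
  ext j
  simp [inner_e_left, e_apply]

theorem sum_inner_smul_map {V : Type*} [AddCommGroup V] [Module ℝ V] (f : E6 →ₗ[ℝ] V) (x : E6) :
    ∑ i, ⟪e i, x⟫_ℝ • f (e i) = f x := by
  conv_rhs => rw [← sum_inner_smul_e x, map_sum]
  simp only [map_smul]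

theorem basisFun_eq (i : Fin 6) : (EuclideanSpace.basisFun (Fin 6) ℝ).toBasis i = e i := by
  simp [e]

theorem linearMap_ext_e {V : Type*} [AddCommGroup V] [Module ℝ V] {f g : E6 →ₗ[ℝ] V}
    (h : ∀ i, f (e i) = g (e i)) : f = g :=
  (EuclideanSpace.basisFun (Fin 6) ℝ).toBasis.ext fun i => by rw [basisFun_eq, h]

theorem form_two_ext_e {S T : Form 2} (h : ∀ i j, S ![e i, e j] = T ![e i, e j]) : S = T := by
  refine Module.Basis.ext_alternating (EuclideanSpace.basisFun (Fin 6) ℝ).toBasis fun v _ => ?_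
  simp only [basisFun_eq]
  rw [form_two_eta, form_two_eta T]
  exact h _ _

theorem form_three_ext_e {S T : Form 3}
    (h : ∀ i j k, i < j → j < k → S ![e i, e j, e k] = T ![e i, e j, e k]) : S = T := by
  have h' : ∀ i j k, i ≠ j → j ≠ k → i ≠ k → S ![e i, e j, e k] = T ![e i, e j, e k] := by
    intro i j k hij hjk hik
    rcases lt_or_gt_of_ne hij with a | a <;> rcases lt_or_gt_of_ne hjk with b | b <;>
      rcases lt_or_gt_of_ne hik with c | c
    · exact h _ _ _ a b
    · exact absurd (a.trans b) c.not_gt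
    · rw [form_three_swap12, form_three_swap12 T, h _ _ _ c b]
    · rw [← form_three_rot, ← form_three_rot T, h _ _ _ c a]
    · rw [form_three_swap01, form_three_swap01 T, h _ _ _ a c]
    · rw [form_three_rot, form_three_rot T, h _ _ _ b c]
    · exact absurd (b.trans a) c.not_gt
    · rw [form_three_swap12, form_three_swap12 T, form_three_rot, form_three_rot T, h _ _ _ b a]
  refine Module.Basis.ext_alternating (EuclideanSpace.basisFun (Fin 6) ℝ).toBasis fun v hv => ?_
  simp only [basisFun_eq]
  rw [form_three_eta, form_three_eta T]
  exact h' _ _ _ (hv.ne (by decide)) (hv.ne (by decide)) (hv.ne (by decide))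

theorem J_e0 : J (e 0) = e 1 := by ext i; fin_cases i <;> simp [J, e_apply]
theorem J_e1 : J (e 1) = -e 0 := by ext i; fin_cases i <;> simp [J, e_apply]
theorem J_e2 : J (e 2) = e 3 := by ext i; fin_cases i <;> simp [J, e_apply]
theorem J_e3 : J (e 3) = -e 2 := by ext i; fin_cases i <;> simp [J, e_apply]
theorem J_e4 : J (e 4) = e 5 := by ext i; fin_cases i <;> simp [J, e_apply]
theorem J_e5 : J (e 5) = -e 4 := by ext i; fin_cases i <;> simp [J, e_apply]

theorem inner_J_left (x y : E6) : ⟪J x, y⟫_ℝ = -⟪x, J y⟫_ℝ := by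
  simp [J, PiLp.inner_apply, Fin.sum_univ_succ]
  ring

theorem inner_J_J (x y : E6) : ⟪J x, J y⟫_ℝ = ⟪x, y⟫_ℝ := by
  rw [inner_J_left, J_J, inner_neg_right, neg_neg]

/-! ### Endomorphisms acting on forms -/

/-- The action of an endomorphism on `3`-forms as a derivation. -/
def act (L : E6 →ₗ[ℝ] E6) : Form 3 →ₗ[ℝ] Form 3 :=
  ∑ i, wedge (innerₗ E6 (e i) ∘ₗ L) ∘ₗ contract (e i)

theorem sum_wedge_contract_apply (L : E6 →ₗ[ℝ] E6) (f : E6 →ₗ[ℝ] Form 2) (u v w : E6) :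
    (∑ i, wedge (innerₗ E6 (e i) ∘ₗ L) (f (e i))) ![u, v, w] =
      f (L u) ![v, w] - f (L v) ![u, w] + f (L w) ![u, v] := by
  rw [← sum_inner_smul_map f (L u), ← sum_inner_smul_map f (L v), ← sum_inner_smul_map f (L w)]
  simp only [form_sum_apply, wedge_apply_three, LinearMap.comp_apply,
    innerₗ_apply_apply, AlternatingMap.smul_apply, smul_eq_mul, Finset.sum_add_distrib,
    Finset.sum_sub_distrib]

theorem act_apply (L : E6 →ₗ[ℝ] E6) (T : Form 3) (u v w : E6) :
    act L T ![u, v, w] = T ![L u, v, w] + T ![u, L v, w] + T ![u, v, L w] := by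
  have h := sum_wedge_contract_apply L (contractₗ T) u v w
  simp only [contractₗ_apply, contract_apply_two] at h
  rw [act, LinearMap.sum_apply]
  simp only [LinearMap.comp_apply]
  rw [h, form_three_swap01 T u (L v), ← form_three_rot T (L w) u v]
  ring

theorem act_add (L M : E6 →ₗ[ℝ] E6) (T : Form 3) : act (L + M) T = act L T + act M T := by
  refine form_three_ext fun u v w => ?_
  rw [AlternatingMap.add_apply, act_apply, act_apply, act_apply]
  simp only [LinearMap.add_apply, form_three_add0, form_three_add1, form_three_add2]
  ring

theorem act_smul (c : ℝ) (L : E6 →ₗ[ℝ] E6) (T : Form 3) : act (c • L) T = c • act L T := by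
  refine form_three_ext fun u v w => ?_
  rw [AlternatingMap.smul_apply, act_apply, act_apply]
  simp only [LinearMap.smul_apply, form_three_smul0, form_three_smul1, form_three_smul2,
    smul_eq_mul]
  ring

theorem τ_eq_act (T : Form 3) : τ T = -act J T := by
  have h : ∀ i, toFunctional (contract (e i) Ω) = -(innerₗ E6 (e i) ∘ₗ J) := by
    intro i
    ext x
    change ⟪J (e i), x⟫_ℝ = -⟪e i, J x⟫_ℝ
    exact inner_J_left _ _
  simp only [τ, act, h, LinearMap.sum_apply, LinearMap.comp_apply, map_neg, LinearMap.neg_apply,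
    Finset.sum_neg_distrib]

theorem τ_apply (T : Form 3) (u v w : E6) :
    τ T ![u, v, w] = -(T ![J u, v, w] + T ![u, J v, w] + T ![u, v, J w]) := by
  rw [τ_eq_act, AlternatingMap.neg_apply, act_apply]

/-- The conjugate of an endomorphism of `ℝ⁶` by an element of `U(3)`. -/
def conjEnd (A : U3) (L : E6 →ₗ[ℝ] E6) : E6 →ₗ[ℝ] E6 := stdRep A ∘ₗ L ∘ₗ stdRep A⁻¹

theorem conjEnd_apply (A : U3) (L : E6 →ₗ[ℝ] E6) (x : E6) :
    conjEnd A L x = A.1 (L ((A⁻¹).1 x)) := rfl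

theorem formRep_act (A : U3) (L : E6 →ₗ[ℝ] E6) (T : Form 3) :
    formRep 3 A (act L T) = act (conjEnd A L) (formRep 3 A T) := by
  refine form_three_ext fun u v w => ?_
  rw [formRep_apply_three, act_apply, act_apply]
  simp only [formRep_apply_three, conjEnd_apply, U3_inv_apply]

theorem formRep_τ (A : U3) (T : Form 3) : formRep 3 A (τ T) = τ (formRep 3 A T) := by
  have : conjEnd A J = J := by
    ext1 x
    rw [conjEnd_apply, U3_comm_J, U3_apply_inv]
  rw [τ_eq_act, τ_eq_act, map_neg, formRep_act, this]

/-! ### Relations between `τ` and `J` -/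

theorem formJ_formJ_three (T : Form 3) : formJ 3 (formJ 3 T) = -T :=
  LinearMap.congr_fun formJ_mul_formJ_three T

theorem τ_formJ (T : Form 3) : τ (formJ 3 T) = formJ 3 (τ T) := by
  refine form_three_ext fun u v w => ?_
  simp only [τ_apply, formJ_apply_three]

theorem τ_τ (T : Form 3) : τ (τ T) = (2 : ℝ) • formJ 3 (τ T) - (3 : ℝ) • T := by
  refine form_three_ext fun u v w => ?_
  simp only [AlternatingMap.sub_apply, AlternatingMap.smul_apply, smul_eq_mul, τ_apply,
    formJ_apply_three, J_J, form_three_neg0, form_three_neg1, form_three_neg2]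
  ring

theorem formJ_injective : Function.Injective (formJ 3) := fun S T h => by
  have := congrArg (formJ 3) h
  rwa [formJ_formJ_three, formJ_formJ_three, neg_inj] at this

theorem τ_τ_eq_neg_nine_iff (T : Form 3) :
    τ (τ T) = (-9 : ℝ) • T ↔ τ T = (3 : ℝ) • formJ 3 T := by
  constructor
  · intro h
    rw [τ_τ] at h
    apply formJ_injective
    rw [map_smul, formJ_formJ_three]
    have h2 : (2 : ℝ) • formJ 3 (τ T) = (2 : ℝ) • ((3 : ℝ) • -T) := by
      rw [sub_eq_iff_eq_add.1 h]; module
    exact smul_right_injective _ two_ne_zero h2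
  · intro h
    rw [τ_τ, h, map_smul, formJ_formJ_three]
    module

theorem τ_τ_eq_neg_iff (T : Form 3) : τ (τ T) = -T ↔ τ T = -formJ 3 T := by
  constructor
  · intro h
    rw [τ_τ] at h
    apply formJ_injective
    rw [map_neg, formJ_formJ_three]
    have h2 : (2 : ℝ) • formJ 3 (τ T) = (2 : ℝ) • - -T := by
      rw [sub_eq_iff_eq_add.1 h]; module
    exact smul_right_injective _ two_ne_zero h2
  · intro h
    rw [τ_τ, h, map_neg, formJ_formJ_three]
    module

/-! ### The trace of a `3`-form and the Hodge operator -/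

/-- The contraction of a `3`-form with the Kähler form. -/
def kaehlerTrace : Form 3 →ₗ[ℝ] E6 where
  toFun T := ∑ k, (T ![e 0, e 1, e k] + T ![e 2, e 3, e k] + T ![e 4, e 5, e k]) • e k
  map_add' S T := by
    simp only [AlternatingMap.add_apply, ← Finset.sum_add_distrib, ← add_smul]
    refine Finset.sum_congr rfl fun k _ => ?_
    ring_nf
  map_smul' c T := by
    simp only [AlternatingMap.smul_apply, smul_eq_mul, Finset.smul_sum, smul_smul, ← mul_add,
      RingHom.id_apply]

theorem inner_kaehlerTrace (T : Form 3) (x : E6) :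
    ⟪kaehlerTrace T, x⟫_ℝ = T ![e 0, e 1, x] + T ![e 2, e 3, x] + T ![e 4, e 5, x] := by
  have h : ∀ u v, T ![u, v, x] = ∑ k, x k * T ![u, v, e k] := by
    intro u v
    rw [← form_three_rot, ← contract_apply_two, ← contractₗ_apply,
      ← sum_inner_smul_map (contractₗ T) x]
    simp only [form_sum_apply, AlternatingMap.smul_apply, smul_eq_mul, inner_e_left,
      contractₗ_apply, contract_apply_two, form_three_rot T (e _) u v]
  simp only [kaehlerTrace, LinearMap.coe_mk, AddHom.coe_mk, sum_inner, inner_smul_left,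
    inner_e_left, h, ← Finset.sum_add_distrib]
  refine Finset.sum_congr rfl fun k _ => ?_
  simp
  ring

/-- The `3`-form `X ∧ Ω`. -/
def wedgeΩ : E6 →ₗ[ℝ] Form 3 := wedge.flip Ω ∘ₗ innerₗ E6

theorem wedgeΩ_apply (X u v w : E6) :
    wedgeΩ X ![u, v, w] = ⟪X, u⟫_ℝ * ⟪J v, w⟫_ℝ - ⟪X, v⟫_ℝ * ⟪J u, w⟫_ℝ
      + ⟪X, w⟫_ℝ * ⟪J u, v⟫_ℝ :=
  wedge_apply_three _ _ _ _ _

theorem mem_Λ6 {T : Form 3} : T ∈ Λ6 ↔ ∃ X, wedgeΩ X = T := Iff.rfl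

theorem formJ_wedgeΩ (X : E6) : formJ 3 (wedgeΩ X) = -wedgeΩ (J X) := by
  refine form_three_ext fun u v w => ?_
  simp only [AlternatingMap.neg_apply, formJ_apply_three, wedgeΩ_apply, inner_J_left,
    J_J, inner_neg_left]
  ring

theorem τ_wedgeΩ (X : E6) : τ (wedgeΩ X) = wedgeΩ (J X) := by
  refine form_three_ext fun u v w => ?_
  simp only [τ_apply, wedgeΩ_apply, inner_J_left, J_J, inner_neg_left, inner_neg_right]
  ring

theorem kaehlerTrace_wedgeΩ (X : E6) : kaehlerTrace (wedgeΩ X) = (2 : ℝ) • X := by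
  refine ext_inner_right ℝ fun x => ?_
  rw [inner_kaehlerTrace]
  simp only [wedgeΩ_apply, J_e0, J_e1, J_e2, J_e3, J_e4, J_e5, inner_neg_left,
    inner_e_left, inner_e_right, e_apply]
  simp [PiLp.inner_apply, Fin.sum_univ_succ]
  ring

theorem lt_lt_cases {i j k : Fin 6} (h : i < j) (h' : j < k) :
    (i, j, k) ∈ ([(0, 1, 2), (0, 1, 3), (0, 1, 4), (0, 1, 5), (0, 2, 3), (0, 2, 4), (0, 2, 5),
      (0, 3, 4), (0, 3, 5), (0, 4, 5), (1, 2, 3), (1, 2, 4), (1, 2, 5), (1, 3, 4), (1, 3, 5),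
      (1, 4, 5), (2, 3, 4), (2, 3, 5), (2, 4, 5), (3, 4, 5)] : List (Fin 6 × Fin 6 × Fin 6)) := by
  revert i j k; decide

theorem vol_e {x : Fin 6 → Fin 6} (hx : Function.Bijective x) :
    vol (fun i => e (x i)) = ((∏ i, ∏ j ∈ Finset.Ioi i, if x i < x j then 1 else -1 : ℤ) : ℝ) := by
  have h : vol (fun i => e (x i)) = vol ((fun i => e i) ∘ Equiv.ofBijective x hx) := rfl
  have h1 : vol (fun i => e i) = 1 := by
    have := (EuclideanSpace.basisFun (Fin 6) ℝ).toBasis.det_self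
    rwa [show ⇑(EuclideanSpace.basisFun (Fin 6) ℝ).toBasis = fun i => e i from
      funext basisFun_eq] at this
  have h2 := Equiv.Perm.sign_eq_prod_prod_Ioi (Equiv.ofBijective x hx)
  rw [h, AlternatingMap.map_perm, h1, Units.smul_def, h2]
  simp [apply_ite]

theorem hodge_apply_e (T : Form 3) (a b c i j k : Fin 6) (s : ℤ) (hij : i < j ∧ j < k)
    (hb : Function.Bijective ![i, j, k, a, b, c])
    (hu : ∀ i' j' k' : Fin 6, i' < j' → j' < k' → (i', j', k') ≠ (i, j, k) →
      ¬ Function.Injective ![i', j', k', a, b, c])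
    (hs : ∏ p, ∏ q ∈ Finset.Ioi p,
      (if ![i, j, k, a, b, c] p < ![i, j, k, a, b, c] q then 1 else -1 : ℤ) = s) :
    hodge T ![e a, e b, e c] = s * T ![e i, e j, e k] := by
  have hv : ∀ i' j' k', contract (e k') (contract (e j') (contract (e i') vol)) ![e a, e b, e c]
      = vol (fun p => e (![i', j', k', a, b, c] p)) := by
    intro i' j' k'
    exact congrArg vol (funext fun p => by fin_cases p <;> rfl)
  simp only [hodge, LinearMap.coe_mk, AddHom.coe_mk, form_sum_apply]
  rw [Finset.sum_eq_single i, Finset.sum_eq_single j, Finset.sum_eq_single k, if_pos hij,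
    AlternatingMap.smul_apply, hv, vol_e hb, hs, smul_eq_mul, mul_comm]
  all_goals first | (intro h; exact absurd (Finset.mem_univ _) h) | skip
  all_goals
    intro x _ hx
    try refine Finset.sum_eq_zero fun y _ => ?_
    try refine Finset.sum_eq_zero fun z _ => ?_
    split_ifs with h
    · rw [AlternatingMap.smul_apply, hv, smul_eq_mul]
      refine mul_eq_zero_of_right _ (AlternatingMap.map_eq_zero_of_not_injective _ _ fun hinj => ?_)
      refine hu _ _ _ h.1 h.2 ?_ fun p q hpq => hinj (congrArg e hpq)
      simp [hx]
    · rfl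

theorem form_three_sort01 (T : Form 3) {i j : Fin 6} (_ : j < i) (w : E6) :
    T ![e i, e j, w] = -T ![e j, e i, w] := form_three_swap01 T _ _ _

theorem form_three_sort12 (T : Form 3) {i j : Fin 6} (_ : j < i) (w : E6) :
    T ![w, e i, e j] = -T ![w, e j, e i] := form_three_swap12 T _ _ _

set_option maxHeartbeats 2000000 in
set_option linter.unusedSimpArgs false in
theorem hodge_eq (T : Form 3) : hodge T = formJ 3 T + wedgeΩ (J (kaehlerTrace T)) := by
  have key : ∀ a b c : Fin 6, (formJ 3 T + wedgeΩ (J (kaehlerTrace T))) ![e a, e b, e c] =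
      T ![J (e a), J (e b), J (e c)]
      - (T ![e 0, e 1, J (e a)] + T ![e 2, e 3, J (e a)] + T ![e 4, e 5, J (e a)]) * J (e b) c
      + (T ![e 0, e 1, J (e b)] + T ![e 2, e 3, J (e b)] + T ![e 4, e 5, J (e b)]) * J (e a) c
      - (T ![e 0, e 1, J (e c)] + T ![e 2, e 3, J (e c)] + T ![e 4, e 5, J (e c)]) * J (e a) b := by
    intro a b c
    rw [AlternatingMap.add_apply, formJ_apply_three, wedgeΩ_apply]
    simp only [inner_J_left (kaehlerTrace T), inner_kaehlerTrace, inner_e_right]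
    ring
  refine form_three_ext_e fun a b c hab hbc => ?_
  have := lt_lt_cases hab hbc
  rw [key]
  simp only [List.mem_cons, Prod.mk.injEq, List.not_mem_nil, or_false] at this
  rcases this with h | h | h | h | h | h | h | h | h | h | h | h | h | h | h | h | h | h | h | h <;>
    obtain ⟨rfl, rfl, rfl⟩ := h
  rw [hodge_apply_e T 0 1 2 3 4 5 (-1) (by decide) (by decide) (by decide) (by decide)]; rotate_left
  rw [hodge_apply_e T 0 1 3 2 4 5 1 (by decide) (by decide) (by decide) (by decide)]; rotate_left
  rw [hodge_apply_e T 0 1 4 2 3 5 (-1) (by decide) (by decide) (by decide) (by decide)]; rotate_left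
  rw [hodge_apply_e T 0 1 5 2 3 4 1 (by decide) (by decide) (by decide) (by decide)]; rotate_left
  rw [hodge_apply_e T 0 2 3 1 4 5 (-1) (by decide) (by decide) (by decide) (by decide)]; rotate_left
  rw [hodge_apply_e T 0 2 4 1 3 5 1 (by decide) (by decide) (by decide) (by decide)]; rotate_left
  rw [hodge_apply_e T 0 2 5 1 3 4 (-1) (by decide) (by decide) (by decide) (by decide)]; rotate_left
  rw [hodge_apply_e T 0 3 4 1 2 5 (-1) (by decide) (by decide) (by decide) (by decide)]; rotate_left
  rw [hodge_apply_e T 0 3 5 1 2 4 1 (by decide) (by decide) (by decide) (by decide)]; rotate_left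
  rw [hodge_apply_e T 0 4 5 1 2 3 (-1) (by decide) (by decide) (by decide) (by decide)]; rotate_left
  rw [hodge_apply_e T 1 2 3 0 4 5 1 (by decide) (by decide) (by decide) (by decide)]; rotate_left
  rw [hodge_apply_e T 1 2 4 0 3 5 (-1) (by decide) (by decide) (by decide) (by decide)]; rotate_left
  rw [hodge_apply_e T 1 2 5 0 3 4 1 (by decide) (by decide) (by decide) (by decide)]; rotate_left
  rw [hodge_apply_e T 1 3 4 0 2 5 1 (by decide) (by decide) (by decide) (by decide)]; rotate_left
  rw [hodge_apply_e T 1 3 5 0 2 4 (-1) (by decide) (by decide) (by decide) (by decide)]; rotate_left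
  rw [hodge_apply_e T 1 4 5 0 2 3 1 (by decide) (by decide) (by decide) (by decide)]; rotate_left
  rw [hodge_apply_e T 2 3 4 0 1 5 (-1) (by decide) (by decide) (by decide) (by decide)]; rotate_left
  rw [hodge_apply_e T 2 3 5 0 1 4 1 (by decide) (by decide) (by decide) (by decide)]; rotate_left
  rw [hodge_apply_e T 2 4 5 0 1 3 (-1) (by decide) (by decide) (by decide) (by decide)]; rotate_left
  rw [hodge_apply_e T 3 4 5 0 1 2 1 (by decide) (by decide) (by decide) (by decide)]; rotate_left
  all_goals
    simp [J_e0, J_e1, J_e2, J_e3, J_e4, J_e5, e_apply, form_three_sort01, form_three_sort12,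
      form_three_neg0, form_three_neg1, form_three_neg2, form_three_self01, form_three_self12,
      form_three_self02]

/-! ### The components of `Λ³(ℝ⁶)` -/

theorem J_injective : Function.Injective J := fun x y h => by
  have := congrArg J h
  rwa [J_J, J_J, neg_inj] at this

theorem wedgeΩ_injective : Function.Injective wedgeΩ := fun X Y h => by
  have := congrArg kaehlerTrace h
  rw [kaehlerTrace_wedgeΩ, kaehlerTrace_wedgeΩ] at this
  exact smul_right_injective _ two_ne_zero this

theorem formJ_eq_hodge_iff (T : Form 3) : formJ 3 T = hodge T ↔ kaehlerTrace T = 0 := by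
  rw [hodge_eq, eq_comm, add_eq_left, map_eq_zero_iff _ wedgeΩ_injective,
    map_eq_zero_iff _ J_injective]

theorem kaehlerTrace_formJ (T : Form 3) : kaehlerTrace (formJ 3 T) = -J (kaehlerTrace T) := by
  refine ext_inner_right ℝ fun x => ?_
  rw [inner_neg_left, inner_J_left, neg_neg, inner_kaehlerTrace, inner_kaehlerTrace]
  simp only [formJ_apply_three, J_e0, J_e1, J_e2, J_e3, J_e4, J_e5, form_three_neg1,
    form_three_swap01 T (e 1) (e 0), form_three_swap01 T (e 3) (e 2),
    form_three_swap01 T (e 5) (e 4), neg_neg]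

theorem kaehlerTrace_τ (T : Form 3) : kaehlerTrace (τ T) = J (kaehlerTrace T) := by
  refine ext_inner_right ℝ fun x => ?_
  rw [inner_J_left, inner_kaehlerTrace, inner_kaehlerTrace]
  simp only [τ_apply, J_e0, J_e1, J_e2, J_e3, J_e4, J_e5, form_three_neg1, form_three_self01]
  ring

theorem kaehlerTrace_eq_zero_of_τ {T : Form 3} (h : τ T = (3 : ℝ) • formJ 3 T) :
    kaehlerTrace T = 0 := by
  have h1 := congrArg kaehlerTrace h
  rw [kaehlerTrace_τ, map_smul, kaehlerTrace_formJ, ← sub_eq_zero] at h1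
  have h2 : J ((4 : ℝ) • kaehlerTrace T) = 0 := by
    rw [map_smul, ← h1]; module
  rw [map_eq_zero_iff _ J_injective] at h2
  exact (smul_eq_zero.1 h2).resolve_left four_ne_zero

theorem mem_Λ2 {T : Form 3} : T ∈ Λ2 ↔ τ T = (3 : ℝ) • formJ 3 T := by
  change (τ (τ T) = (-9 : ℝ) • T ∧ formJ 3 T = hodge T) ↔ _
  rw [τ_τ_eq_neg_nine_iff, formJ_eq_hodge_iff]
  exact ⟨fun h => h.1, fun h => ⟨h, kaehlerTrace_eq_zero_of_τ h⟩⟩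

theorem mem_Λ12 {T : Form 3} : T ∈ Λ12 ↔ τ T = -formJ 3 T ∧ kaehlerTrace T = 0 := by
  change (τ (τ T) = -T ∧ formJ 3 T = hodge T) ↔ _
  rw [τ_τ_eq_neg_iff, formJ_eq_hodge_iff]

theorem mem_Λ2_iff_hodge (T : Form 3) :
    T ∈ Λ2 ↔ formJ 3 T = hodge T ∧ τ T = (3 : ℝ) • hodge T := by
  rw [mem_Λ2]
  constructor
  · intro h
    have := (formJ_eq_hodge_iff T).2 (kaehlerTrace_eq_zero_of_τ h)
    exact ⟨this, this ▸ h⟩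
  · rintro ⟨h1, h2⟩
    rw [h1, h2]

theorem mem_Λ12_iff_hodge (T : Form 3) : T ∈ Λ12 ↔ formJ 3 T = hodge T ∧ τ T = -hodge T := by
  rw [mem_Λ12, ← formJ_eq_hodge_iff]
  constructor
  · rintro ⟨h1, h2⟩
    exact ⟨h2, h2 ▸ h1⟩
  · rintro ⟨h1, h2⟩
    exact ⟨h1 ▸ h2, h1⟩

theorem mem_Λ6_iff_hodge (T : Form 3) : T ∈ Λ6 ↔ formJ 3 T = -hodge T := by
  rw [mem_Λ6]
  constructor
  · rintro ⟨X, rfl⟩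
    rw [hodge_eq, kaehlerTrace_wedgeΩ, formJ_wedgeΩ, map_smul, map_smul]
    module
  · intro h
    rw [hodge_eq] at h
    refine ⟨(1 / 2 : ℝ) • kaehlerTrace T, formJ_injective ?_⟩
    rw [map_smul, map_smul, formJ_wedgeΩ]
    have h2 : formJ 3 T + formJ 3 T = -wedgeΩ (J (kaehlerTrace T)) := by
      exact eq_neg_of_add_eq_zero_left (by rw [add_assoc]; exact eq_neg_iff_add_eq_zero.1 h)
    rw [← h2]; module

theorem τ_of_mem_Λ6 {T : Form 3} (h : T ∈ Λ6) : τ T = -formJ 3 T := by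
  obtain ⟨X, rfl⟩ := mem_Λ6.1 h
  rw [τ_wedgeΩ, formJ_wedgeΩ, neg_neg]

theorem τ_eq_hodge_of_mem_Λ6 {T : Form 3} (h : T ∈ Λ6) : τ T = hodge T := by
  rw [τ_of_mem_Λ6 h, (mem_Λ6_iff_hodge T).1 h, neg_neg]

theorem isInternal_of_existsUnique_sum {V : Type*} [AddCommGroup V] [Module ℝ V] {n : ℕ}
    (W : Fin n → Submodule ℝ V)
    (h1 : ∀ x, ∃ f : Fin n → V, (∀ i, f i ∈ W i) ∧ ∑ i, f i = x)
    (h2 : ∀ f : Fin n → V, (∀ i, f i ∈ W i) → ∑ i, f i = 0 → ∀ i, f i = 0) :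
    DirectSum.IsInternal W := by
  rw [DirectSum.isInternal_submodule_iff_iSupIndep_and_iSup_eq_top]
  constructor
  · rw [iSupIndep_iff_finsetSum_eq_zero_imp_eq_zero]
    intro s v hv hs i hi
    have := h2 (fun j => if j ∈ s then v j else 0) (fun j => ?_) ?_ i
    · simpa [hi] using this
    · by_cases h : j ∈ s
      · simpa [h] using hv j h
      · simp [h]
    · simpa using hs
  · rw [eq_top_iff]
    intro x _
    obtain ⟨f, hf, rfl⟩ := h1 x
    exact Submodule.sum_mem _ fun i _ => Submodule.mem_iSup_of_mem i (hf i)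

theorem exists_Λ_decomposition (T : Form 3) :
    ∃ a ∈ Λ2, ∃ b ∈ Λ6, ∃ c ∈ Λ12, a + b + c = T := by
  set a : Form 3 := (-1 / 4 : ℝ) • (formJ 3 (τ T) - T) with ha
  set b : Form 3 := (1 / 2 : ℝ) • wedgeΩ (kaehlerTrace T) with hb
  have ha' : a ∈ Λ2 := by
    rw [mem_Λ2, ha]
    simp only [map_smul, map_sub, τ_formJ, τ_τ, formJ_formJ_three]
    module
  have hb' : b ∈ Λ6 := Λ6.smul_mem _ (mem_Λ6.2 ⟨_, rfl⟩)
  refine ⟨a, ha', b, hb', T - a - b, mem_Λ12.2 ⟨?_, ?_⟩, by abel⟩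
  · have h : τ (T - a) = -formJ 3 (T - a) := by
      rw [ha]
      simp only [map_smul, map_sub, τ_formJ, τ_τ, formJ_formJ_three]
      module
    rw [map_sub τ (T - a) b, h, τ_of_mem_Λ6 hb', map_sub (formJ 3) (T - a) b]
    abel
  · rw [map_sub, map_sub, kaehlerTrace_eq_zero_of_τ (mem_Λ2.1 ha'), hb, map_smul,
      kaehlerTrace_wedgeΩ]
    module

theorem Λ_sum_eq_zero {a b c : Form 3} (ha : a ∈ Λ2) (hb : b ∈ Λ6) (hc : c ∈ Λ12)
    (h : a + b + c = 0) : a = 0 ∧ b = 0 ∧ c = 0 := by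
  have hb' := τ_of_mem_Λ6 hb
  have hc' := mem_Λ12.1 hc
  have ha0 : a = 0 := by
    have h1 : τ (a + b + c) + formJ 3 (a + b + c) = (4 : ℝ) • formJ 3 a := by
      simp only [map_add, mem_Λ2.1 ha, hb', hc'.1]
      module
    rw [h, map_zero, map_zero, add_zero, eq_comm, smul_eq_zero,
      map_eq_zero_iff _ formJ_injective] at h1
    exact h1.resolve_left four_ne_zero
  subst ha0
  rw [zero_add] at h
  have hb0 : b = 0 := by
    obtain ⟨X, rfl⟩ := mem_Λ6.1 hb
    have h1 := congrArg kaehlerTrace h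
    rw [map_add, hc'.2, kaehlerTrace_wedgeΩ, add_zero, map_zero, smul_eq_zero] at h1
    rw [h1.resolve_left two_ne_zero, map_zero]
  subst hb0
  exact ⟨rfl, rfl, by rwa [zero_add] at h⟩

theorem isInternal_Λ : DirectSum.IsInternal ![Λ2, Λ6, Λ12] := by
  refine isInternal_of_existsUnique_sum _ (fun T => ?_) fun f hf h => ?_
  · obtain ⟨a, ha, b, hb, c, hc, h⟩ := exists_Λ_decomposition T
    refine ⟨![a, b, c], fun i => ?_, ?_⟩
    · fin_cases i
      exacts [ha, hb, hc]
    · rw [Fin.sum_univ_three]; exact h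
  · rw [Fin.sum_univ_three] at h
    have := Λ_sum_eq_zero (hf 0) (hf 1) (hf 2) h
    intro i; fin_cases i
    exacts [this.1, this.2.1, this.2.2]

/-! ### Dimensions -/

theorem finrank_form (k : ℕ) : Module.finrank ℝ (Form k) = Nat.choose 6 k := by
  refine (exteriorPower.alternatingMapLinearEquiv (R := ℝ) (M := E6) (N := ℝ)
    (n := k)).finrank_eq.trans (Subspace.dual_finrank_eq.trans ?_)
  rw [exteriorPower.finrank_eq, finrank_euclideanSpace_fin]

instance finiteDimensional_form (k : ℕ) : FiniteDimensional ℝ (Form k) :=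
  Module.Finite.equiv (exteriorPower.alternatingMapLinearEquiv (R := ℝ) (M := E6) (N := ℝ)
    (n := k)).symm

instance free_submodule_form (k : ℕ) (W : Submodule ℝ (Form k)) : Module.Free ℝ W :=
  Module.Free.of_divisionRing ℝ W

theorem finrank_Λ6 : Module.finrank ℝ Λ6 = 6 := by
  have : Module.finrank ℝ (LinearMap.range wedgeΩ) = 6 := by
    rw [LinearMap.finrank_range_of_inj wedgeΩ_injective, finrank_euclideanSpace_fin]
  exact this

theorem finrank_Λ_add : Module.finrank ℝ Λ2 + Module.finrank ℝ Λ6 + Module.finrank ℝ Λ12 = 20 := by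
  let f : (Λ2 × Λ6) × Λ12 →ₗ[ℝ] Form 3 := (Λ2.subtype.coprod Λ6.subtype).coprod Λ12.subtype
  have hf : ∀ x, f x = x.1.1 + x.1.2 + x.2 := fun x => rfl
  have h : Function.Bijective f := by
    constructor
    · rw [injective_iff_map_eq_zero]
      intro x hx
      obtain ⟨h1, h2, h3⟩ := Λ_sum_eq_zero x.1.1.2 x.1.2.2 x.2.2 (hf x ▸ hx)
      exact Prod.ext (Prod.ext (Subtype.ext h1) (Subtype.ext h2)) (Subtype.ext h3)
    · intro T
      obtain ⟨a, ha, b, hb, c, hc, h⟩ := exists_Λ_decomposition T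
      exact ⟨((⟨a, ha⟩, ⟨b, hb⟩), ⟨c, hc⟩), h⟩
  have h2 := (LinearEquiv.ofBijective f h).finrank_eq
  rwa [finrank_form, Module.finrank_prod, Module.finrank_prod] at h2

/-! ### Complex coordinates -/

/-- The identification `ℝ⁶ = ℂ³` as a real linear equivalence. -/
def toC3ₗ : E6 ≃ₗ[ℝ] (Fin 3 → ℂ) where
  toFun := toC3
  invFun z := !₂[(z 0).re, (z 0).im, (z 1).re, (z 1).im, (z 2).re, (z 2).im]
  map_add' x y := by ext i; fin_cases i <;> simp [toC3, Complex.ext_iff]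
  map_smul' c x := by ext i; fin_cases i <;> simp [toC3, Complex.ext_iff]
  left_inv x := by ext i; fin_cases i <;> simp [toC3]
  right_inv z := by ext i; fin_cases i <;> simp [toC3]

theorem toC3ₗ_apply (x : E6) : toC3ₗ x = toC3 x := rfl

theorem toC3_symm (z : Fin 3 → ℂ) : toC3 (toC3ₗ.symm z) = z := toC3ₗ.apply_symm_apply z

theorem toC3_injective : Function.Injective toC3 := toC3ₗ.injective

theorem toC3_e0 : toC3 (e 0) = ![1, 0, 0] := by
  ext i; fin_cases i <;> simp [toC3, e_apply, Complex.ext_iff]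
theorem toC3_e1 : toC3 (e 1) = ![Complex.I, 0, 0] := by
  ext i; fin_cases i <;> simp [toC3, e_apply, Complex.ext_iff]
theorem toC3_e2 : toC3 (e 2) = ![0, 1, 0] := by
  ext i; fin_cases i <;> simp [toC3, e_apply, Complex.ext_iff]
theorem toC3_e3 : toC3 (e 3) = ![0, Complex.I, 0] := by
  ext i; fin_cases i <;> simp [toC3, e_apply, Complex.ext_iff]
theorem toC3_e4 : toC3 (e 4) = ![0, 0, 1] := by
  ext i; fin_cases i <;> simp [toC3, e_apply, Complex.ext_iff]
theorem toC3_e5 : toC3 (e 5) = ![0, 0, Complex.I] := by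
  ext i; fin_cases i <;> simp [toC3, e_apply, Complex.ext_iff]

theorem inner_eq_re_dotProduct (x y : E6) : ⟪x, y⟫_ℝ = (star (toC3 x) ⬝ᵥ toC3 y).re := by
  simp [PiLp.inner_apply, Fin.sum_univ_succ, toC3, dotProduct]
  ring

/-- The complex linear endomorphism of `ℝ⁶ = ℂ³` given by a matrix. -/
def matEnd : Matrix (Fin 3) (Fin 3) ℂ →ₗ[ℝ] E6 →ₗ[ℝ] E6 :=
  LinearMap.mk₂ ℝ (fun M x => toC3ₗ.symm (M.mulVec (toC3ₗ x)))
    (fun M N x => by rw [Matrix.add_mulVec, map_add])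
    (fun c M x => by rw [Matrix.smul_mulVec, map_smul])
    (fun M x y => by rw [map_add, Matrix.mulVec_add, map_add])
    (fun c M x => by rw [map_smul, Matrix.mulVec_smul, map_smul])

/-- The complex antilinear endomorphism `z ↦ B z̄` of `ℝ⁶ = ℂ³` given by a matrix. -/
def antiEnd : Matrix (Fin 3) (Fin 3) ℂ →ₗ[ℝ] E6 →ₗ[ℝ] E6 :=
  LinearMap.mk₂ ℝ (fun M x => toC3ₗ.symm (M.mulVec (star (toC3ₗ x))))
    (fun M N x => by rw [Matrix.add_mulVec, map_add])
    (fun c M x => by rw [Matrix.smul_mulVec, map_smul])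
    (fun M x y => by rw [map_add, star_add, Matrix.mulVec_add, map_add])
    (fun c M x => by rw [map_smul, star_smul, star_trivial, Matrix.mulVec_smul, map_smul])

theorem toC3_matEnd (M : Matrix (Fin 3) (Fin 3) ℂ) (x : E6) :
    toC3 (matEnd M x) = M.mulVec (toC3 x) := toC3_symm _

theorem toC3_antiEnd (M : Matrix (Fin 3) (Fin 3) ℂ) (x : E6) :
    toC3 (antiEnd M x) = M.mulVec (star (toC3 x)) := toC3_symm _

theorem matEnd_I_smul (M : Matrix (Fin 3) (Fin 3) ℂ) : matEnd (Complex.I • M) = J ∘ₗ matEnd M := by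
  ext1 x
  apply toC3_injective
  rw [LinearMap.comp_apply, toC3_J, toC3_matEnd, toC3_matEnd, Matrix.smul_mulVec]

theorem matEnd_mul (M N : Matrix (Fin 3) (Fin 3) ℂ) : matEnd (M * N) = matEnd M ∘ₗ matEnd N := by
  ext1 x
  apply toC3_injective
  rw [LinearMap.comp_apply, toC3_matEnd, toC3_matEnd, toC3_matEnd, Matrix.mulVec_mulVec]

theorem matEnd_one : matEnd 1 = LinearMap.id := by
  ext1 x
  apply toC3_injective
  rw [toC3_matEnd, Matrix.one_mulVec, LinearMap.id_apply]

theorem matEnd_I : matEnd (Complex.I • 1) = J := by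
  rw [matEnd_I_smul, matEnd_one, LinearMap.comp_id]

theorem matEnd_J (M : Matrix (Fin 3) (Fin 3) ℂ) (x : E6) : matEnd M (J x) = J (matEnd M x) := by
  apply toC3_injective
  rw [toC3_J, toC3_matEnd, toC3_matEnd, toC3_J, Matrix.mulVec_smul]

theorem antiEnd_J (M : Matrix (Fin 3) (Fin 3) ℂ) (x : E6) :
    antiEnd M (J x) = -J (antiEnd M x) := by
  apply toC3_injective
  rw [← toC3ₗ_apply (-_), map_neg, toC3ₗ_apply, toC3_J, toC3_antiEnd, toC3_antiEnd, toC3_J,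
    star_smul, Matrix.mulVec_smul, Complex.star_def, Complex.conj_I, neg_smul]

/-- The element of `U(3)` given by a unitary matrix. -/
def ofUnitary (M : Matrix (Fin 3) (Fin 3) ℂ) (hM : M ∈ Matrix.unitaryGroup (Fin 3) ℂ) : U3 where
  val := (LinearEquiv.ofLinearMap (matEnd M) (matEnd (star M))
      (by rw [← matEnd_mul, Matrix.mem_unitaryGroup_iff.1 hM, matEnd_one])
      (by rw [← matEnd_mul, Matrix.mem_unitaryGroup_iff'.1 hM, matEnd_one])).isometryOfInner
    fun x y => by
      rw [LinearEquiv.coe_ofLinearMap, inner_eq_re_dotProduct,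
        inner_eq_re_dotProduct, toC3_matEnd, toC3_matEnd, Matrix.star_mulVec,
        Matrix.dotProduct_mulVec, Matrix.vecMul_vecMul, ← Matrix.star_eq_conjTranspose,
        Matrix.mem_unitaryGroup_iff'.1 hM, Matrix.vecMul_one]
  property := by
    refine ⟨?_, fun x => matEnd_J M x⟩
    have h : (matEnd M) = toC3ₗ.symm ∘ₗ ((Matrix.toLin' M).restrictScalars ℝ) ∘ₗ
        (toC3ₗ.symm.symm : E6 →ₗ[ℝ] (Fin 3 → ℂ)) := rfl
    change LinearMap.det (matEnd M) = 1
    rw [h, LinearMap.det_conj, LinearMap.det_restrictScalars, LinearMap.det_toLin',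
      Algebra.norm_complex_apply, Complex.normSq_eq_norm_sq]
    have h2 := (Matrix.det_of_mem_unitary hM)
    rw [CStarRing.norm_of_mem_unitary h2, one_pow]

theorem ofUnitary_apply {M : Matrix (Fin 3) (Fin 3) ℂ} (hM : M ∈ Matrix.unitaryGroup (Fin 3) ℂ)
    (x : E6) : (ofUnitary M hM).1 x = matEnd M x := rfl

theorem ofUnitary_inv_apply {M : Matrix (Fin 3) (Fin 3) ℂ}
    (hM : M ∈ Matrix.unitaryGroup (Fin 3) ℂ) (x : E6) :
    ((ofUnitary M hM)⁻¹).1 x = matEnd (star M) x := rfl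

/-- The element of `SU(3)` given by a special unitary matrix. -/
def ofSpecialUnitary (M : Matrix (Fin 3) (Fin 3) ℂ)
    (hM : M ∈ Matrix.specialUnitaryGroup (Fin 3) ℂ) : SU3 :=
  ⟨ofUnitary M (Matrix.mem_specialUnitaryGroup_iff.1 hM).1, M, hM, toC3_matEnd M⟩

theorem conjEnd_ofUnitary_matEnd {M : Matrix (Fin 3) (Fin 3) ℂ}
    (hM : M ∈ Matrix.unitaryGroup (Fin 3) ℂ) (N : Matrix (Fin 3) (Fin 3) ℂ) :
    conjEnd (ofUnitary M hM) (matEnd N) = matEnd (M * N * star M) := by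
  ext1 x
  rw [conjEnd_apply, ofUnitary_apply, ofUnitary_inv_apply, matEnd_mul, matEnd_mul]
  rfl

theorem conjEnd_ofUnitary_antiEnd {M : Matrix (Fin 3) (Fin 3) ℂ}
    (hM : M ∈ Matrix.unitaryGroup (Fin 3) ℂ) (N : Matrix (Fin 3) (Fin 3) ℂ) :
    conjEnd (ofUnitary M hM) (antiEnd N) = antiEnd (M * N * M.transpose) := by
  ext1 x
  rw [conjEnd_apply, ofUnitary_apply, ofUnitary_inv_apply]
  apply toC3_injective
  rw [toC3_matEnd, toC3_antiEnd, toC3_antiEnd, toC3_matEnd, Matrix.star_mulVec,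
    Matrix.star_eq_conjTranspose, Matrix.conjTranspose_conjTranspose, ← Matrix.mulVec_transpose,
    Matrix.mulVec_mulVec, Matrix.mulVec_mulVec, Matrix.mul_assoc]

/-! ### The complex volume form -/

/-- The determinant of three vectors of `ℂ³`. -/
def det3 (a b c : Fin 3 → ℂ) : ℂ :=
  a 0 * b 1 * c 2 - a 0 * b 2 * c 1 - a 1 * b 0 * c 2 + a 1 * b 2 * c 0 + a 2 * b 0 * c 1
    - a 2 * b 1 * c 0

theorem det3_eq_det (a b c : Fin 3 → ℂ) : det3 a b c = (Matrix.of ![a, b, c]).det := by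
  rw [Matrix.det_fin_three]; rfl

theorem det3_mulVec (M : Matrix (Fin 3) (Fin 3) ℂ) (a b c : Fin 3 → ℂ) :
    det3 (M.mulVec a) (M.mulVec b) (M.mulVec c) = M.det * det3 a b c := by
  have h : Matrix.of ![M.mulVec a, M.mulVec b, M.mulVec c] =
      Matrix.of ![a, b, c] * M.transpose := by
    ext i j
    fin_cases i <;> simp [Matrix.mul_apply, Matrix.mulVec, dotProduct, mul_comm]
  rw [det3_eq_det, det3_eq_det, h, Matrix.det_mul, Matrix.det_transpose, mul_comm]

theorem toC3_add (x y : E6) : toC3 (x + y) = toC3 x + toC3 y := toC3ₗ.map_add x y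

theorem toC3_smul (r : ℝ) (x : E6) : toC3 (r • x) = (r : ℂ) • toC3 x := toC3ₗ.map_smul r x

/-- The real part of a complex multiple of the complex volume form `dz₁ ∧ dz₂ ∧ dz₃`. -/
def psi : ℂ →ₗ[ℝ] Form 3 where
  toFun c :=
    { toFun := fun v => (c * det3 (toC3 (v 0)) (toC3 (v 1)) (toC3 (v 2))).re
      map_update_add' := @fun inst v i x y => by
        obtain rfl : inst = instDecidableEqFin 3 := Subsingleton.elim _ _
        rw [← Complex.add_re]
        congr 1
        fin_cases i <;> simp [Function.update, toC3_add, det3] <;> ring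
      map_update_smul' := @fun inst v i r x => by
        obtain rfl : inst = instDecidableEqFin 3 := Subsingleton.elim _ _
        rw [smul_eq_mul, ← Complex.re_ofReal_mul]
        congr 1
        fin_cases i <;> simp [Function.update, toC3_smul, det3] <;> ring
      map_eq_zero_of_eq' := fun v i j h hij => by
        rw [← Complex.zero_re]
        congr 1
        fin_cases i <;> fin_cases j <;> simp at hij h <;> simp [h, det3] <;> ring_nf <;> simp }
  map_add' c d := by ext v; exact (congrArg Complex.re (add_mul _ _ _)).trans (Complex.add_re _ _)
  map_smul' r c := by
    ext v
    change (r • c * _).re = r * (c * _).re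
    rw [smul_mul_assoc, Complex.smul_re, smul_eq_mul]

theorem psi_apply (c : ℂ) (u v w : E6) :
    psi c ![u, v, w] = (c * det3 (toC3 u) (toC3 v) (toC3 w)).re := rfl

theorem psi_J0 (c : ℂ) (u v w : E6) : psi c ![J u, v, w] = psi (Complex.I * c) ![u, v, w] := by
  rw [psi_apply, psi_apply, toC3_J]
  congr 1
  simp [det3]
  ring

theorem psi_J1 (c : ℂ) (u v w : E6) : psi c ![u, J v, w] = psi (Complex.I * c) ![u, v, w] := by
  rw [form_three_swap01, psi_J0, ← form_three_swap01]

theorem psi_J2 (c : ℂ) (u v w : E6) : psi c ![u, v, J w] = psi (Complex.I * c) ![u, v, w] := by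
  rw [form_three_swap12, psi_J1, ← form_three_swap12]

theorem act_matEnd_psi (M : Matrix (Fin 3) (Fin 3) ℂ) (c : ℂ) :
    act (matEnd M) (psi c) = psi (M.trace * c) := by
  refine form_three_ext fun u v w => ?_
  rw [act_apply]
  simp only [psi_apply, toC3_matEnd, ← Complex.add_re]
  congr 1
  simp [det3, Matrix.mulVec, dotProduct, Fin.sum_univ_three, Matrix.trace]
  ring

theorem psi_mem_Λ2 (c : ℂ) : psi c ∈ Λ2 := by
  rw [mem_Λ2]
  refine form_three_ext fun u v w => ?_
  rw [τ_apply, AlternatingMap.smul_apply, formJ_apply_three]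
  simp only [psi_J0, psi_J1, psi_J2]
  have : Complex.I * (Complex.I * (Complex.I * c)) = -(Complex.I * c) := by
    linear_combination (Complex.I * c) * Complex.I_mul_I
  rw [this, map_neg, AlternatingMap.neg_apply, smul_eq_mul]
  ring

theorem Λ2_J_J {T : Form 3} (h : T ∈ Λ2) (u v w : E6) : T ![J u, J v, w] = -T ![u, v, w] := by
  have h2 : ∀ u v w : E6, T ![J u, J v, w] + T ![J u, v, J w] + T ![u, J v, J w]
      = -3 * T ![u, v, w] := by
    intro u v w
    have := congrArg (fun S : Form 3 => S ![J u, J v, J w]) (mem_Λ2.1 h)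
    simp only [τ_apply, AlternatingMap.smul_apply, formJ_apply_three, J_J, form_three_neg0,
      form_three_neg1, form_three_neg2, smul_eq_mul] at this
    linarith
  have h3 := h2 (J u) (J v) w
  simp only [J_J, form_three_neg0, form_three_neg1, neg_neg] at h3
  linarith [h2 u v w]

theorem Λ2_J {T : Form 3} (h : T ∈ Λ2) (u v w : E6) : T ![J u, v, w] = T ![u, J v, w] := by
  have := Λ2_J_J h (J u) v w
  rw [J_J, form_three_neg0] at this
  linarith

theorem eq_zero_of_mem_Λ2 {T : Form 3} (h : T ∈ Λ2) (h0 : T ![e 0, e 2, e 4] = 0)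
    (h1 : T ![e 1, e 2, e 4] = 0) : T = 0 := by
  have hJJ := Λ2_J_J h
  have hJ := Λ2_J h
  have hz : ∀ u w, T ![u, J u, w] = 0 := fun u w => by
    have := hJ u u w
    rw [form_three_swap01] at this
    linarith
  have hz' : ∀ u w, T ![w, u, J u] = 0 := fun u w => by rw [form_three_rot, hz]
  have hJ' : ∀ u v w, T ![u, v, J w] = T ![J u, v, w] := fun u v w => by
    rw [form_three_swap12, ← hJ, form_three_swap12 T (J u), neg_neg]
  refine form_three_ext_e fun a b c hab hbc => ?_
  have := lt_lt_cases hab hbc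
  simp only [List.mem_cons, Prod.mk.injEq, List.not_mem_nil, or_false] at this
  rw [AlternatingMap.zero_apply]
  rcases this with h | h | h | h | h | h | h | h | h | h | h | h | h | h | h | h | h | h | h | h <;>
    obtain ⟨rfl, rfl, rfl⟩ := h <;>
    simp only [← J_e0, ← J_e2, ← J_e4, hz, hz', hJ', ← hJ, J_J, form_three_neg0, h0, neg_zero] <;>
    simp only [J_e0, map_neg, form_three_neg0, h1, neg_zero]

theorem mem_Λ2_iff_psi {T : Form 3} : T ∈ Λ2 ↔ ∃ c, psi c = T := by
  constructor
  · intro h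
    refine ⟨⟨T ![e 0, e 2, e 4], -T ![e 1, e 2, e 4]⟩, sub_eq_zero.1
      (eq_zero_of_mem_Λ2 (Λ2.sub_mem (psi_mem_Λ2 _) h) ?_ ?_)⟩
    · rw [AlternatingMap.sub_apply, psi_apply, toC3_e0, toC3_e2, toC3_e4]
      simp [det3]
    · rw [AlternatingMap.sub_apply, psi_apply, toC3_e1, toC3_e2, toC3_e4]
      simp [det3]
  · rintro ⟨c, rfl⟩
    exact psi_mem_Λ2 c

theorem psi_injective : Function.Injective psi := by
  rw [injective_iff_map_eq_zero]
  intro c hc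
  have h0 := congrArg (fun S : Form 3 => S ![e 0, e 2, e 4]) hc
  have h1 := congrArg (fun S : Form 3 => S ![e 1, e 2, e 4]) hc
  simp only [psi_apply, toC3_e0, toC3_e1, toC3_e2, toC3_e4] at h0 h1
  simp [det3] at h0 h1
  exact Complex.ext h0 h1

theorem finrank_Λ2 : Module.finrank ℝ Λ2 = 2 := by
  have h : Λ2 = LinearMap.range psi := by
    ext T; rw [mem_Λ2_iff_psi]; rfl
  rw [h, LinearMap.finrank_range_of_inj psi_injective, Complex.finrank_real_complex]

theorem finrank_Λ12 : Module.finrank ℝ Λ12 = 12 := by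
  have := finrank_Λ_add
  rw [finrank_Λ2, finrank_Λ6] at this
  omega

theorem formRep_psi (A : SU3) (c : ℂ) : formRep 3 A.1 (psi c) = psi c := by
  obtain ⟨N, hN, hA⟩ := (A⁻¹).2
  refine form_three_ext fun u v w => ?_
  rw [formRep_apply_three]
  have hA' : ∀ x, toC3 ((A.1⁻¹).1 x) = N.mulVec (toC3 x) := hA
  rw [psi_apply, psi_apply, hA', hA', hA', det3_mulVec,
    (Matrix.mem_specialUnitaryGroup_iff.1 hN).2, one_mul]

/-! ### Some special unitary matrices -/

theorem mem_specialUnitary_of_mul_star {M : Matrix (Fin 3) (Fin 3) ℂ} (h : M * star M = 1)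
    (h' : M.det = 1) : M ∈ Matrix.specialUnitaryGroup (Fin 3) ℂ :=
  Matrix.mem_specialUnitaryGroup_iff.2 ⟨Matrix.mem_unitaryGroup_iff.2 h, h'⟩

theorem diagonal_mem_specialUnitary {a b c : ℂ} (ha : a * star a = 1) (hb : b * star b = 1)
    (hc : c * star c = 1) (h : a * b * c = 1) :
    !![a, 0, 0; 0, b, 0; 0, 0, c] ∈ Matrix.specialUnitaryGroup (Fin 3) ℂ := by
  refine mem_specialUnitary_of_mul_star ?_ (by simp [Matrix.det_fin_three, h])
  ext i j
  fin_cases i <;> fin_cases j <;>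
    simp [Matrix.mul_apply, Fin.sum_univ_three]
  exacts [ha, hb, hc]

/-- A cyclic permutation matrix. -/
def cycMat : Matrix (Fin 3) (Fin 3) ℂ := !![0, 1, 0; 0, 0, 1; 1, 0, 0]

/-- A rational rotation in the first two coordinates. -/
def rotMat : Matrix (Fin 3) (Fin 3) ℂ := !![3 / 5, -4 / 5, 0; 4 / 5, 3 / 5, 0; 0, 0, 1]

/-- A rotation in the first two coordinates with non-real entries. -/
def rotMatI : Matrix (Fin 3) (Fin 3) ℂ :=
  !![3 / 5, 4 / 5 * Complex.I, 0; 4 / 5 * Complex.I, 3 / 5, 0; 0, 0, 1]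

theorem star_cycMat : star cycMat = !![0, 0, 1; 1, 0, 0; 0, 1, 0] := by
  ext i j
  fin_cases i <;> fin_cases j <;> simp [cycMat]

theorem star_rotMat : star rotMat = !![3 / 5, 4 / 5, 0; -4 / 5, 3 / 5, 0; 0, 0, 1] := by
  ext i j
  fin_cases i <;> fin_cases j <;> simp [rotMat]

theorem star_rotMatI : star rotMatI =
    !![3 / 5, -4 / 5 * Complex.I, 0; -4 / 5 * Complex.I, 3 / 5, 0; 0, 0, 1] := by
  ext i j
  fin_cases i <;> fin_cases j <;> simp [rotMatI] <;> ring

theorem cycMat_mem : cycMat ∈ Matrix.specialUnitaryGroup (Fin 3) ℂ := by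
  refine mem_specialUnitary_of_mul_star ?_ (by simp [cycMat, Matrix.det_fin_three])
  ext i j
  fin_cases i <;> fin_cases j <;> simp [cycMat, Matrix.mul_apply, Fin.sum_univ_three]

theorem rotMat_mem : rotMat ∈ Matrix.specialUnitaryGroup (Fin 3) ℂ := by
  refine mem_specialUnitary_of_mul_star ?_ (by simp [rotMat, Matrix.det_fin_three]; norm_num)
  rw [star_rotMat]
  ext i j
  fin_cases i <;> fin_cases j <;>
    simp [rotMat, Matrix.mul_apply, Fin.sum_univ_three] <;> norm_num

theorem rotMatI_mem : rotMatI ∈ Matrix.specialUnitaryGroup (Fin 3) ℂ := by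
  have hI := Complex.I_mul_I
  refine mem_specialUnitary_of_mul_star ?_ ?_
  · rw [star_rotMatI]
    ext i j
    fin_cases i <;> fin_cases j <;>
      simp [rotMatI, Matrix.mul_apply, Fin.sum_univ_three] <;>
      first | ring1 | linear_combination (-16 / 25 : ℂ) * hI
  · simp [rotMatI, Matrix.det_fin_three]
    linear_combination (-16 / 25 : ℂ) * hI

/-! ### Symmetric matrices -/

/-- The symmetric matrix with the given diagonal entries `v 0, v 1, v 2` and the entries
`v 3, v 4, v 5` in the positions `(0, 1), (0, 2), (1, 2)`. -/
def symMat : (Fin 6 → ℂ) →ₗ[ℂ] Matrix (Fin 3) (Fin 3) ℂ where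
  toFun v := !![v 0, v 3, v 4; v 3, v 1, v 5; v 4, v 5, v 2]
  map_add' v w := by ext i j; fin_cases i <;> fin_cases j <;> rfl
  map_smul' c v := by ext i j; fin_cases i <;> fin_cases j <;> rfl

theorem symMat_apply (v : Fin 6 → ℂ) :
    symMat v = !![v 0, v 3, v 4; v 3, v 1, v 5; v 4, v 5, v 2] := rfl

theorem symMat_congr_diagonal (a b c : ℂ) (v : Fin 6 → ℂ) :
    !![a, 0, 0; 0, b, 0; 0, 0, c] * symMat v * (!![a, 0, 0; 0, b, 0; 0, 0, c]).transpose =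
      symMat ![a * a * v 0, b * b * v 1, c * c * v 2, a * b * v 3, a * c * v 4, b * c * v 5] := by
  ext i j
  fin_cases i <;> fin_cases j <;>
    simp [symMat_apply, Matrix.mul_apply, Fin.sum_univ_three] <;> ring

theorem symMat_congr_cycMat (v : Fin 6 → ℂ) :
    cycMat * symMat v * cycMat.transpose = symMat ![v 1, v 2, v 0, v 5, v 3, v 4] := by
  ext i j
  fin_cases i <;> fin_cases j <;>
    simp [symMat_apply, cycMat, Matrix.mul_apply, Fin.sum_univ_three]

theorem symMat_congr_rotMat (v : Fin 6 → ℂ) :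
    rotMat * symMat v * rotMat.transpose =
      symMat ![(9 * v 0 - 24 * v 3 + 16 * v 1) / 25, (16 * v 0 + 24 * v 3 + 9 * v 1) / 25, v 2,
        (12 * v 0 - 7 * v 3 - 12 * v 1) / 25, (3 * v 4 - 4 * v 5) / 5,
        (4 * v 4 + 3 * v 5) / 5] := by
  ext i j
  fin_cases i <;> fin_cases j <;>
    simp [symMat_apply, rotMat, Matrix.mul_apply, Fin.sum_univ_three] <;> ring

theorem symMat_congr_rotMatI (v : Fin 6 → ℂ) :
    rotMatI * symMat v * rotMatI.transpose =
      symMat ![(9 * v 0 + 24 * Complex.I * v 3 - 16 * v 1) / 25,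
        (-16 * v 0 + 24 * Complex.I * v 3 + 9 * v 1) / 25, v 2,
        (12 * Complex.I * v 0 - 7 * v 3 + 12 * Complex.I * v 1) / 25,
        (3 * v 4 + 4 * Complex.I * v 5) / 5, (4 * Complex.I * v 4 + 3 * v 5) / 5] := by
  have hI := Complex.I_sq
  ext i j
  fin_cases i <;> fin_cases j <;>
    simp [symMat_apply, rotMatI, Matrix.mul_apply, Fin.sum_univ_three] <;> ring_nf <;>
    simp only [hI] <;> ring

theorem symMat_mem_of_congr_closed (S : Submodule ℂ (Matrix (Fin 3) (Fin 3) ℂ))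
    (hS : ∀ g ∈ Matrix.specialUnitaryGroup (Fin 3) ℂ, ∀ v, symMat v ∈ S →
      g * symMat v * g.transpose ∈ S)
    {v₀ : Fin 6 → ℂ} (hv₀ : v₀ ≠ 0) (h₀ : symMat v₀ ∈ S) (w : Fin 6 → ℂ) : symMat w ∈ S := by
  set T := S.comap symMat with hT
  have hcyc : ∀ v ∈ T, ![v 1, v 2, v 0, v 5, v 3, v 4] ∈ T := fun v hv => by
    have := hS _ cycMat_mem v hv
    rwa [symMat_congr_cycMat] at this
  have hrot : ∀ v ∈ T, ![(9 * v 0 - 24 * v 3 + 16 * v 1) / 25,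
      (16 * v 0 + 24 * v 3 + 9 * v 1) / 25, v 2, (12 * v 0 - 7 * v 3 - 12 * v 1) / 25,
      (3 * v 4 - 4 * v 5) / 5, (4 * v 4 + 3 * v 5) / 5] ∈ T := fun v hv => by
    have := hS _ rotMat_mem v hv
    rwa [symMat_congr_rotMat] at this
  have hrotI : ∀ v ∈ T, ![(9 * v 0 + 24 * Complex.I * v 3 - 16 * v 1) / 25,
      (-16 * v 0 + 24 * Complex.I * v 3 + 9 * v 1) / 25, v 2,
      (12 * Complex.I * v 0 - 7 * v 3 + 12 * Complex.I * v 1) / 25,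
      (3 * v 4 + 4 * Complex.I * v 5) / 5, (4 * Complex.I * v 4 + 3 * v 5) / 5] ∈ T :=
    fun v hv => by
      have := hS _ rotMatI_mem v hv
      rwa [symMat_congr_rotMatI] at this
  have hdiag : ∀ a b c : ℂ, a * star a = 1 → b * star b = 1 → c * star c = 1 → a * b * c = 1 →
      ∀ v ∈ T, ![a * a * v 0, b * b * v 1, c * c * v 2, a * b * v 3, a * c * v 4, b * c * v 5]
        ∈ T := fun a b c ha hb hc h v hv => by
    have := hS _ (diagonal_mem_specialUnitary ha hb hc h) v hv
    rwa [symMat_congr_diagonal] at this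
  have hF : ∀ v ∈ T, v 3 ≠ 0 → ![0, 0, 0, 1, 0, 0] ∈ T := fun v hv h => by
    have h1 := hdiag (-1) (-1) 1 (by simp) (by simp) (by simp) (by simp) v hv
    have h2 := hdiag 1 (-1) (-1) (by simp) (by simp) (by simp) (by simp) v hv
    have h3 := hdiag (-1) 1 (-1) (by simp) (by simp) (by simp) (by simp) v hv
    have h4 := T.smul_mem (1 / (4 * v 3)) (T.sub_mem (T.sub_mem (T.add_mem hv h1) h2) h3)
    convert h4 using 1
    ext i
    simp only [Pi.smul_apply, Pi.add_apply, Pi.sub_apply]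
    fin_cases i <;> simp <;> first | done | ring1 | (field_simp; ring1)
  have hF' : ![0, 0, 0, 1, 0, 0] ∈ T := by
    by_contra hn
    have hz3 : ∀ v ∈ T, v 3 = 0 := fun v hv => by
      by_contra h; exact hn (hF v hv h)
    have hz5 : ∀ v ∈ T, v 5 = 0 := fun v hv => hz3 _ (hcyc v hv)
    have hz4 : ∀ v ∈ T, v 4 = 0 := fun v hv => hz5 _ (hcyc v hv)
    have hz0 : ∀ v ∈ T, v 0 = 0 := fun v hv => by
      have h1 := hz3 _ (hrot v hv)
      have h2 := hz3 _ (hrotI v hv)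
      simp [hz3 v hv] at h1 h2
      have h3 : Complex.I * (v 0 + v 1) = 0 := by linear_combination h2 / 12
      have h4 := (mul_eq_zero.1 h3).resolve_left Complex.I_ne_zero
      linear_combination h1 / 24 + h4 / 2
    have hz1 : ∀ v ∈ T, v 1 = 0 := fun v hv => hz0 _ (hcyc v hv)
    have hz2 : ∀ v ∈ T, v 2 = 0 := fun v hv => hz1 _ (hcyc v hv)
    refine hv₀ (funext fun i => ?_)
    fin_cases i
    exacts [hz0 _ h₀, hz1 _ h₀, hz2 _ h₀, hz3 _ h₀, hz4 _ h₀, hz5 _ h₀]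
  have hE : ![1, 0, 0, 0, 0, 0] ∈ T := by
    have h1 := hrot _ hF'
    have h2 := hrotI _ hF'
    have h3 := T.sub_mem (T.smul_mem (-25 / 48) (T.add_mem h1 (T.smul_mem (7 / 25) hF')))
      (T.smul_mem (25 / 48 * Complex.I) (T.add_mem h2 (T.smul_mem (7 / 25) hF')))
    convert h3 using 1
    ext i
    fin_cases i <;> simp <;> ring_nf <;> simp <;> norm_num
  have hF4 := hcyc _ hF'
  have hF5 := hcyc _ hF4
  have hE2 := hcyc _ hE
  have hE1 := hcyc _ hE2
  have := T.add_mem (T.add_mem (T.add_mem (T.smul_mem (w 0) hE) (T.smul_mem (w 1) hE1))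
    (T.add_mem (T.smul_mem (w 2) hE2) (T.smul_mem (w 3) hF')))
    (T.add_mem (T.smul_mem (w 4) hF4) (T.smul_mem (w 5) hF5))
  change w ∈ T
  convert this using 1
  ext i
  fin_cases i <;> simp

/-! ### Matrices of trace zero -/

theorem conj_diagonal_apply (a b c : ℂ) (M : Matrix (Fin 3) (Fin 3) ℂ) (i j : Fin 3) :
    (!![a, 0, 0; 0, b, 0; 0, 0, c] * M * star !![a, 0, 0; 0, b, 0; 0, 0, c]) i j =
      ![a, b, c] i * M i j * star (![a, b, c] j) := by
  simp only [Matrix.mul_apply, Fin.sum_univ_three]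
  fin_cases i <;> fin_cases j <;> simp

theorem conj_cycMat_apply (M : Matrix (Fin 3) (Fin 3) ℂ) (i j : Fin 3) :
    (cycMat * M * star cycMat) i j = M (i + 1) (j + 1) := by
  simp only [star_cycMat, Matrix.mul_apply, Fin.sum_univ_three]
  fin_cases i <;> fin_cases j <;> simp [cycMat]

theorem mem_of_conj_closed (S : Submodule ℂ (Matrix (Fin 3) (Fin 3) ℂ))
    (htr : ∀ M ∈ S, M.trace = 0)
    (hS : ∀ g ∈ Matrix.specialUnitaryGroup (Fin 3) ℂ, ∀ M ∈ S, g * M * star g ∈ S)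
    {M₀ : Matrix (Fin 3) (Fin 3) ℂ} (hM₀ : M₀ ≠ 0) (h₀ : M₀ ∈ S)
    {N : Matrix (Fin 3) (Fin 3) ℂ} (hN : N.trace = 0) : N ∈ S := by
  have hcyc := hS _ cycMat_mem
  have hrot := hS _ rotMat_mem
  have hoff : ∀ M ∈ S, (M 0 1 ≠ 0 → !![0, 1, 0; 0, 0, 0; 0, 0, 0] ∈ S) ∧
      (M 1 0 ≠ 0 → !![0, 0, 0; 1, 0, 0; 0, 0, 0] ∈ S) := fun M hM => by
    have h1 := hS _ (diagonal_mem_specialUnitary (a := -1) (b := -1) (c := 1)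
      (by simp) (by simp) (by simp) (by simp)) M hM
    have h2 := hS _ (diagonal_mem_specialUnitary (a := 1) (b := -1) (c := -1)
      (by simp) (by simp) (by simp) (by simp)) M hM
    have h3 := hS _ (diagonal_mem_specialUnitary (a := -1) (b := 1) (c := -1)
      (by simp) (by simp) (by simp) (by simp)) M hM
    have h4 := S.sub_mem (S.sub_mem (S.add_mem hM h1) h2) h3
    have h5 := hS _ (diagonal_mem_specialUnitary (a := Complex.I) (b := 1) (c := -Complex.I)
      (by simp) (by simp) (by simp) (by simp)) _ h4
    have h6 := S.smul_mem Complex.I h5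
    constructor
    · intro h
      convert S.smul_mem (1 / (8 * M 0 1)) (S.sub_mem h4 h6) using 1
      ext i j
      simp only [Matrix.smul_apply, Matrix.sub_apply, Matrix.add_apply, conj_diagonal_apply]
      fin_cases i <;> fin_cases j <;> simp <;> ring_nf <;> simp [h] <;> norm_num
    · intro h
      convert S.smul_mem (1 / (8 * M 1 0)) (S.add_mem h4 h6) using 1
      ext i j
      simp only [Matrix.smul_apply, Matrix.sub_apply, Matrix.add_apply, conj_diagonal_apply]
      fin_cases i <;> fin_cases j <;> simp <;> ring_nf <;> simp [h] <;> norm_num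
  have hrot01 : !![0, 1, 0; 0, 0, 0; 0, 0, 0] ∈ S →
      !![-12 / 25, 9 / 25, 0; -16 / 25, 12 / 25, 0; 0, 0, 0] ∈ S := fun h => by
    convert hrot _ h using 1
    ext i j
    simp only [star_rotMat, Matrix.mul_apply, Fin.sum_univ_three]
    fin_cases i <;> fin_cases j <;> simp [rotMat] <;> norm_num
  have hrot10 : !![0, 0, 0; 1, 0, 0; 0, 0, 0] ∈ S →
      !![-12 / 25, -16 / 25, 0; 9 / 25, 12 / 25, 0; 0, 0, 0] ∈ S := fun h => by
    convert hrot _ h using 1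
    ext i j
    simp only [star_rotMat, Matrix.mul_apply, Fin.sum_univ_three]
    fin_cases i <;> fin_cases j <;> simp [rotMat] <;> norm_num
  have h10 : !![0, 1, 0; 0, 0, 0; 0, 0, 0] ∈ S → !![0, 0, 0; 1, 0, 0; 0, 0, 0] ∈ S :=
    fun h => (hoff _ (hrot01 h)).2 (by simp)
  have h01 : !![0, 0, 0; 1, 0, 0; 0, 0, 0] ∈ S → !![0, 1, 0; 0, 0, 0; 0, 0, 0] ∈ S :=
    fun h => (hoff _ (hrot10 h)).1 (by simp)
  have hE01 : !![0, 1, 0; 0, 0, 0; 0, 0, 0] ∈ S := by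
    by_contra hn
    have hz01 : ∀ M ∈ S, M 0 1 = 0 := fun M hM => by
      by_contra h; exact hn ((hoff M hM).1 h)
    have hz10 : ∀ M ∈ S, M 1 0 = 0 := fun M hM => by
      by_contra h; exact hn (h01 ((hoff M hM).2 h))
    have hz12 : ∀ M ∈ S, M 1 2 = 0 := fun M hM =>
      (conj_cycMat_apply M 0 1).symm.trans (hz01 _ (hcyc M hM))
    have hz20 : ∀ M ∈ S, M 2 0 = 0 := fun M hM =>
      (conj_cycMat_apply M 1 2).symm.trans (hz12 _ (hcyc M hM))
    have hz21 : ∀ M ∈ S, M 2 1 = 0 := fun M hM =>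
      (conj_cycMat_apply M 1 0).symm.trans (hz10 _ (hcyc M hM))
    have hz02 : ∀ M ∈ S, M 0 2 = 0 := fun M hM =>
      (conj_cycMat_apply M 2 1).symm.trans (hz21 _ (hcyc M hM))
    have hd01 : ∀ M ∈ S, M 0 0 = M 1 1 := fun M hM => by
      have := hz01 _ (hrot M hM)
      simp only [star_rotMat, Matrix.mul_apply, Fin.sum_univ_three] at this
      simp [rotMat, hz01 M hM, hz10 M hM] at this
      linear_combination (25 / 12 : ℂ) * this
    have hd12 : ∀ M ∈ S, M 1 1 = M 2 2 := fun M hM => by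
      have := hd01 _ (hcyc M hM)
      rwa [conj_cycMat_apply, conj_cycMat_apply] at this
    have ht := htr _ h₀
    rw [Matrix.trace_fin_three, hd01 _ h₀, hd12 _ h₀] at ht
    have h22 : M₀ 2 2 = 0 := by linear_combination ht / 3
    have h11 := (hd12 _ h₀).trans h22
    have h00 := (hd01 _ h₀).trans h11
    refine hM₀ (Matrix.ext fun i j => ?_)
    fin_cases i <;> fin_cases j
    exacts [h00, hz01 _ h₀, hz02 _ h₀, hz10 _ h₀, h11, hz12 _ h₀, hz20 _ h₀, hz21 _ h₀, h22]
  have hE10 := h10 hE01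
  have hH : !![1, 0, 0; 0, -1, 0; 0, 0, 0] ∈ S := by
    convert S.smul_mem (-25 / 12) (S.add_mem (S.sub_mem (hrot01 hE01) (S.smul_mem (9 / 25) hE01))
      (S.smul_mem (16 / 25) hE10)) using 1
    ext i j
    fin_cases i <;> fin_cases j <;> simp <;> norm_num
  have h20 := hcyc _ hE01
  have h12 := hcyc _ h20
  have h02 := hcyc _ hE10
  have h21 := hcyc _ h02
  have hH' := hcyc _ hH
  convert S.add_mem (S.add_mem
    (S.add_mem (S.smul_mem (N 0 1) hE01) (S.smul_mem (N 1 0) hE10))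
    (S.add_mem (S.smul_mem (N 2 0) h20) (S.smul_mem (N 0 2) h02)))
    (S.add_mem (S.add_mem (S.smul_mem (N 1 2) h12) (S.smul_mem (N 2 1) h21))
    (S.add_mem (S.smul_mem (-N 1 1) hH) (S.smul_mem (N 2 2) hH'))) using 1
  rw [Matrix.trace_fin_three] at hN
  ext i j
  simp only [Matrix.smul_apply, Matrix.add_apply, conj_cycMat_apply]
  fin_cases i <;> fin_cases j <;> simp
  linear_combination hN

/-! ### Irreducibility criteria -/

section Irreducibility

variable {F G V V' : Type} [Field F] [Group G] [AddCommGroup V] [Module F V] [AddCommGroup V']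
  [Module F V']

theorem isIrreducibleOn_iff {ρ : Representation F G V} {W : Submodule F V} :
    IsIrreducibleOn ρ W ↔ (∀ g, ∀ v ∈ W, ρ g v ∈ W) ∧ W ≠ ⊥ ∧
      ∀ S ≤ W, (∀ g, ∀ v ∈ S, ρ g v ∈ S) → S ≠ ⊥ → S = W := by
  constructor
  · rintro ⟨R, rfl, hR⟩
    refine ⟨fun g v hv => R.apply_mem_toSubmodule g hv, fun h => ?_, fun S hS hinv hne => ?_⟩
    · refine bot_ne_top (α := Subrepresentation R.toRepresentation)
        (Subrepresentation.toSubmodule_injective ?_)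
      change (⊥ : Submodule F R.toSubmodule) = ⊤
      have := (Submodule.subsingleton_iff_eq_bot (p := R.toSubmodule)).2 h
      exact Subsingleton.elim _ _
    · let S' : Subrepresentation R.toRepresentation :=
        ⟨S.comap R.toSubmodule.subtype, fun g v hv => hinv g _ hv⟩
      rcases hR.eq_bot_or_eq_top S' with h | h
      · refine absurd ((Submodule.eq_bot_iff _).2 fun v hv => ?_) hne
        have h1 : (⟨v, hS hv⟩ : R.toSubmodule) ∈ S'.toSubmodule := hv
        rw [h] at h1
        exact congrArg Subtype.val ((Submodule.mem_bot F).1 h1)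
      · refine le_antisymm hS fun v hv => ?_
        have h1 : (⟨v, hv⟩ : R.toSubmodule) ∈ S'.toSubmodule := by
          rw [h]; exact Submodule.mem_top
        exact h1
  · rintro ⟨hinv, hne, h⟩
    let R : Subrepresentation ρ := ⟨W, fun g v hv => hinv g v hv⟩
    refine ⟨R, rfl, ?_⟩
    have : Nontrivial (Subrepresentation R.toRepresentation) := by
      refine ⟨⊥, ⊤, fun h0 => hne ((Submodule.eq_bot_iff _).2 fun v hv => ?_)⟩
      have h1 : (⟨v, hv⟩ : W) ∈ (⊤ : Subrepresentation R.toRepresentation).toSubmodule :=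
        Submodule.mem_top
      rw [← h0] at h1
      exact congrArg Subtype.val ((Submodule.mem_bot F).1 h1)
    refine ⟨fun S => or_iff_not_imp_left.2 fun hS => ?_⟩
    have h1 := h (S.toSubmodule.map W.subtype) (Submodule.map_subtype_le _ _) ?_ ?_
    · apply Subrepresentation.toSubmodule_injective
      refine Submodule.eq_top_iff'.2 fun v => ?_
      have h2 : (v : V) ∈ S.toSubmodule.map W.subtype := by rw [h1]; exact v.2
      obtain ⟨w, hw, hwv⟩ := h2
      rwa [← Subtype.ext hwv]
    · rintro g _ ⟨w, hw, rfl⟩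
      exact ⟨R.toRepresentation g w, S.apply_mem_toSubmodule g hw, rfl⟩
    · intro h0
      refine hS (Subrepresentation.toSubmodule_injective ?_)
      refine (Submodule.eq_bot_iff _).2 fun v hv => W.subtype_injective ?_
      exact (Submodule.eq_bot_iff _).1 h0 _ (Submodule.mem_map_of_mem hv)

theorem IsIrreducibleOn.map {ρ : Representation F G V} {ρ' : Representation F G V'}
    {W : Submodule F V} (h : IsIrreducibleOn ρ W) (f : V →ₗ[F] V')
    (hf : ∀ g v, f (ρ g v) = ρ' g (f v)) (hinj : ∀ v ∈ W, f v = 0 → v = 0) :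
    IsIrreducibleOn ρ' (W.map f) := by
  obtain ⟨hinv, hne, h⟩ := isIrreducibleOn_iff.1 h
  refine isIrreducibleOn_iff.2 ⟨?_, ?_, fun S hS hSinv hS0 => ?_⟩
  · rintro g _ ⟨v, hv, rfl⟩
    exact ⟨ρ g v, hinv g v hv, hf g v⟩
  · intro h0
    exact hne ((Submodule.eq_bot_iff _).2 fun v hv => hinj v hv
      ((Submodule.eq_bot_iff _).1 h0 _ (Submodule.mem_map_of_mem hv)))
  · have h1 := h (W ⊓ S.comap f) inf_le_left
      (fun g v hv => ⟨hinv g v hv.1, by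
        change f (ρ g v) ∈ S
        rw [hf]; exact hSinv g _ hv.2⟩) ?_
    · refine le_antisymm hS ?_
      rintro _ ⟨v, hv, rfl⟩
      rw [SetLike.mem_coe, ← h1] at hv
      exact hv.2
    · intro h0
      refine hS0 ((Submodule.eq_bot_iff _).2 fun w hw => ?_)
      obtain ⟨v, hv, rfl⟩ := hS hw
      rw [(Submodule.eq_bot_iff _).1 h0 v ⟨hv, hw⟩, map_zero]

theorem IsIrreducibleOn.of_resSU3 {ρ : Representation F U3 V} {W : Submodule F V}
    (h : IsIrreducibleOn (resSU3 ρ) W) (hW : ∀ g, ∀ v ∈ W, ρ g v ∈ W) : IsIrreducibleOn ρ W := by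
  obtain ⟨_, hne, h⟩ := isIrreducibleOn_iff.1 h
  exact isIrreducibleOn_iff.2 ⟨hW, hne, fun S hS hinv => h S hS fun g => hinv g.1⟩

end Irreducibility

theorem isComplexIrreducibleOn_of {G : Type} [Group G] {ρ : Representation ℂ G ComplexForm3}
    {σ : Representation ℝ G (Form 3)}
    (hρ : ∀ g T, ρ g (toComplexForm3 T) = toComplexForm3 (σ g T))
    {W : Submodule ℝ (Form 3)} {d : ℕ} (hd : Module.finrank ℝ W = 2 * d) (hd0 : d ≠ 0)
    (hJ : ∀ T ∈ W, formJ 3 T ∈ W) (hinv : ∀ g, ∀ T ∈ W, σ g T ∈ W)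
    (h : ∀ S ≤ W, (∀ T ∈ S, formJ 3 T ∈ S) → (∀ g, ∀ T ∈ S, σ g T ∈ S) → S ≠ ⊥ → S = W) :
    IsComplexIrreducibleOn ρ W d := by
  let S : Submodule ℂ ComplexForm3 :=
    { carrier := {T | toComplexForm3.symm T ∈ W}
      zero_mem' := W.zero_mem
      add_mem' := fun hS hT => W.add_mem hS hT
      smul_mem' := fun z T hT => by
        obtain ⟨T, rfl⟩ := toComplexForm3.surjective T
        rw [complex_smul_def]
        exact W.add_mem (W.smul_mem _ hT) (W.smul_mem _ (hJ _ hT)) }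
  have hreal : ∀ (r : ℝ) (T : Form 3), r • toComplexForm3 T = toComplexForm3 (r • T) := by
    intro r T
    change (r : ℂ) • toComplexForm3 T = _
    rw [complex_smul_def]
    simp
  let f : W ≃ₗ[ℝ] S :=
    { toFun := fun T => ⟨toComplexForm3 T.1, T.2⟩
      invFun := fun T => ⟨toComplexForm3.symm T.1, T.2⟩
      map_add' := fun _ _ => rfl
      map_smul' := fun r T => Subtype.ext (hreal r T.1).symm
      left_inv := fun _ => rfl
      right_inv := fun _ => rfl }
  have hfin : Module.finrank ℂ S = d := by
    have h1 := f.finrank_eq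
    rw [hd, finrank_real_of_complex] at h1
    omega
  refine ⟨S, fun T => Iff.rfl, isIrreducibleOn_iff.2 ⟨?_, ?_, fun R hR hRinv hR0 => ?_⟩, hfin⟩
  · intro g T hT
    obtain ⟨T, rfl⟩ := toComplexForm3.surjective T
    rw [hρ]
    exact hinv g T hT
  · intro h0
    rw [h0, finrank_bot] at hfin
    exact hd0 hfin.symm
  · let R' : Submodule ℝ (Form 3) :=
      { carrier := {T | toComplexForm3 T ∈ R}
        zero_mem' := R.zero_mem
        add_mem' := fun hS hT => R.add_mem hS hT
        smul_mem' := fun r T hT => by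
          change toComplexForm3 (r • T) ∈ R
          rw [← hreal]
          exact R.smul_mem (r : ℂ) hT }
    have h1 : R' = W := h R' (fun T hT => hR hT) (fun T hT => ?_) (fun g T hT => ?_) ?_
    · refine le_antisymm hR fun T hT => ?_
      have : toComplexForm3.symm T ∈ R' := by rw [h1]; exact hT
      exact this
    · have h2 : Complex.I • toComplexForm3 T ∈ R := R.smul_mem Complex.I hT
      rw [complex_smul_def, Complex.I_re, Complex.I_im, zero_smul, zero_add, one_smul] at h2
      exact h2
    · have h2 : ρ g (toComplexForm3 T) ∈ R := hRinv g _ hT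
      rwa [hρ] at h2
    · intro h0
      refine hR0 ((Submodule.eq_bot_iff _).2 fun T hT => ?_)
      have h2 : toComplexForm3.symm T ∈ R' := hT
      rw [h0, Submodule.mem_bot] at h2
      exact h2

/-! ### Irreducibility of the components of `Λ³(ℝ⁶)` -/

theorem U3_inner_left (A : U3) (x y : E6) : ⟪A.1 x, y⟫_ℝ = ⟪x, (A⁻¹).1 y⟫_ℝ := by
  rw [← U3_inner A x, U3_apply_inv]

theorem formRep_wedgeΩ (A : U3) (X : E6) : formRep 3 A (wedgeΩ X) = wedgeΩ (A.1 X) := by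
  refine form_three_ext fun u v w => ?_
  rw [formRep_apply_three, wedgeΩ_apply, wedgeΩ_apply]
  rw [U3_inner_left A X u, U3_inner_left A X v, U3_inner_left A X w]
  simp only [← U3_comm_J A⁻¹, U3_inner]

theorem sum_map_U3 {V : Type*} [AddCommGroup V] [Module ℝ V] (B : E6 →ₗ[ℝ] E6 →ₗ[ℝ] V) (A : U3) :
    ∑ i, B (A.1 (e i)) (A.1 (e i)) = ∑ i, B (e i) (e i) := by
  have h : ∀ i, B (A.1 (e i)) (A.1 (e i)) =
      ∑ j, ⟪e i, (A⁻¹).1 (e j)⟫_ℝ • (B (e j) ∘ₗ stdRep A) (e i) := by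
    intro i
    rw [← LinearMap.flip_apply, ← sum_inner_smul_map (B.flip (A.1 (e i))) (A.1 (e i))]
    refine Finset.sum_congr rfl fun j _ => ?_
    rw [real_inner_comm, U3_inner_left]
    rfl
  simp only [h]
  rw [Finset.sum_comm]
  refine Finset.sum_congr rfl fun j _ => ?_
  rw [sum_inner_smul_map]
  exact congrArg (B (e j)) (U3_apply_inv A (e j))

theorem two_mul_inner_kaehlerTrace (T : Form 3) (x : E6) :
    2 * ⟪kaehlerTrace T, x⟫_ℝ = ∑ i, T ![e i, J (e i), x] := by
  rw [inner_kaehlerTrace, Fin.sum_univ_six]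
  simp only [J_e0, J_e1, J_e2, J_e3, J_e4, J_e5, form_three_neg1, form_three_swap01 T (e 1) (e 0),
    form_three_swap01 T (e 3) (e 2), form_three_swap01 T (e 5) (e 4)]
  ring

theorem kaehlerTrace_formRep (A : U3) (T : Form 3) :
    kaehlerTrace (formRep 3 A T) = A.1 (kaehlerTrace T) := by
  refine ext_inner_right ℝ fun x => mul_left_cancel₀ (two_ne_zero (α := ℝ)) ?_
  rw [U3_inner_left, two_mul_inner_kaehlerTrace, two_mul_inner_kaehlerTrace]
  simp only [formRep_apply_three, U3_comm_J]
  let B : E6 →ₗ[ℝ] E6 →ₗ[ℝ] ℝ := LinearMap.mk₂ ℝ (fun u v => T ![u, J v, (A⁻¹).1 x])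
    (fun u v w => form_three_add0 T u v _ _) (fun c u v => form_three_smul0 T c u _ _)
    (fun u v w => by rw [map_add, form_three_add1])
    (fun c u v => by rw [map_smul, form_three_smul1, smul_eq_mul])
  exact sum_map_U3 B A⁻¹

theorem formRep_mem_Λ2 (A : U3) {T : Form 3} (h : T ∈ Λ2) : formRep 3 A T ∈ Λ2 := by
  rw [mem_Λ2] at h ⊢
  rw [← formRep_τ, h, map_smul, formJ_formRep]

theorem formRep_mem_Λ6 (A : U3) {T : Form 3} (h : T ∈ Λ6) : formRep 3 A T ∈ Λ6 := by
  obtain ⟨X, rfl⟩ := mem_Λ6.1 h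
  rw [formRep_wedgeΩ]
  exact ⟨_, rfl⟩

theorem formRep_mem_Λ12 (A : U3) {T : Form 3} (h : T ∈ Λ12) : formRep 3 A T ∈ Λ12 := by
  rw [mem_Λ12] at h ⊢
  rw [← formRep_τ, h.1, map_neg, formJ_formRep]
  exact ⟨rfl, by rw [kaehlerTrace_formRep, h.2, map_zero]⟩

theorem formJ_mem_Λ2 {T : Form 3} (h : T ∈ Λ2) : formJ 3 T ∈ Λ2 := by
  rw [mem_Λ2] at h ⊢
  rw [τ_formJ, h, map_smul]

theorem formJ_mem_Λ6 {T : Form 3} (h : T ∈ Λ6) : formJ 3 T ∈ Λ6 := by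
  obtain ⟨X, rfl⟩ := mem_Λ6.1 h
  rw [formJ_wedgeΩ, ← map_neg]
  exact ⟨_, rfl⟩

theorem formJ_mem_Λ12 {T : Form 3} (h : T ∈ Λ12) : formJ 3 T ∈ Λ12 := by
  rw [mem_Λ12] at h ⊢
  rw [τ_formJ, h.1, map_neg, kaehlerTrace_formJ, h.2, map_zero, neg_zero]
  exact ⟨rfl, rfl⟩

theorem formJ_psi (c : ℂ) : formJ 3 (psi c) = psi (-Complex.I * c) := by
  refine form_three_ext fun u v w => ?_
  rw [formJ_apply_three, psi_J0, psi_J1, psi_J2]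
  congr 2
  linear_combination (Complex.I * c) * Complex.I_mul_I

theorem eq_Λ2_of_formJ_closed {S : Submodule ℝ (Form 3)} (hS : S ≤ Λ2)
    (hJ : ∀ T ∈ S, formJ 3 T ∈ S) (h0 : S ≠ ⊥) : S = Λ2 := by
  obtain ⟨T, hT, hT0⟩ := Submodule.exists_mem_ne_zero_of_ne_bot h0
  obtain ⟨c, rfl⟩ := mem_Λ2_iff_psi.1 (hS hT)
  have hc : c ≠ 0 := fun h => hT0 (by rw [h, map_zero])
  refine le_antisymm hS fun T' hT' => ?_
  obtain ⟨d, rfl⟩ := mem_Λ2_iff_psi.1 hT'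
  have h1 := S.sub_mem (S.smul_mem (d / c).re hT) (S.smul_mem (d / c).im (hJ _ hT))
  rw [formJ_psi, ← map_smul, ← map_smul, ← map_sub] at h1
  convert h1 using 2
  rw [Complex.real_smul, Complex.real_smul]
  have h2 : d = (d / c) * c := by field_simp
  conv_lhs => rw [h2, ← Complex.re_add_im (d / c)]
  ring

/-- The complex structure as an element of `U(3)`. -/
def jU : U3 := ofUnitary (Complex.I • 1) (by
  rw [Matrix.mem_unitaryGroup_iff, star_smul, star_one, smul_mul_smul_comm, mul_one]
  simp)

theorem jU_apply (x : E6) : jU.1 x = J x := by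
  rw [jU, ofUnitary_apply, matEnd_I]

theorem jU_inv_apply (x : E6) : (jU⁻¹).1 x = -J x := by
  apply jU.1.injective
  rw [U3_apply_inv, jU_apply, map_neg, J_J, neg_neg]

theorem formRep_jU (T : Form 3) : formRep 3 jU T = -formJ 3 T := by
  refine form_three_ext fun u v w => ?_
  rw [formRep_apply_three, jU_inv_apply, jU_inv_apply, jU_inv_apply, AlternatingMap.neg_apply,
    formJ_apply_three, form_three_neg0, form_three_neg1, form_three_neg2, neg_neg]

theorem Λ2_ne_bot : Λ2 ≠ ⊥ := fun h => by
  have := finrank_Λ2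
  rw [h, finrank_bot] at this
  omega

theorem Λ6_ne_bot : Λ6 ≠ ⊥ := fun h => by
  have := finrank_Λ6
  rw [h, finrank_bot] at this
  omega

theorem Λ12_ne_bot : Λ12 ≠ ⊥ := fun h => by
  have := finrank_Λ12
  rw [h, finrank_bot] at this
  omega

theorem isIrreducibleOn_Λ2 : IsIrreducibleOn (formRep 3) Λ2 :=
  isIrreducibleOn_iff.2 ⟨fun A _ h => formRep_mem_Λ2 A h, Λ2_ne_bot, fun S hS hinv h0 =>
    eq_Λ2_of_formJ_closed hS (fun T hT => by
      have := S.neg_mem (hinv jU T hT)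
      rwa [formRep_jU, neg_neg] at this) h0⟩

theorem mem_of_mulVec_closed (S : Submodule ℝ (Fin 3 → ℂ))
    (hS : ∀ g ∈ Matrix.specialUnitaryGroup (Fin 3) ℂ, ∀ v ∈ S, g.mulVec v ∈ S)
    {v₀ : Fin 3 → ℂ} (hv₀ : v₀ ≠ 0) (h₀ : v₀ ∈ S) (w : Fin 3 → ℂ) : w ∈ S := by
  have hcyc : ∀ v ∈ S, ![v 1, v 2, v 0] ∈ S := fun v hv => by
    convert hS _ cycMat_mem v hv using 1
    ext i
    fin_cases i <;> simp [cycMat, Matrix.mulVec, dotProduct, Fin.sum_univ_three]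
  have hdiag : ∀ a b c : ℂ, a * star a = 1 → b * star b = 1 → c * star c = 1 → a * b * c = 1 →
      ∀ v ∈ S, ![a * v 0, b * v 1, c * v 2] ∈ S := fun a b c ha hb hc h v hv => by
    convert hS _ (diagonal_mem_specialUnitary ha hb hc h) v hv using 1
    ext i
    fin_cases i <;> simp [Matrix.mulVec, dotProduct, Fin.sum_univ_three]
  have hfirst : ∀ v ∈ S, v 0 ≠ 0 → ∀ z : ℂ, ![z, 0, 0] ∈ S := fun v hv h z => by
    have h1 := S.add_mem hv (hdiag 1 (-1) (-1) (by simp) (by simp) (by simp) (by simp) v hv)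
    have h2 := hdiag Complex.I (-Complex.I) 1 (by simp) (by simp) (by simp) (by simp) _ h1
    convert S.add_mem (S.smul_mem (z / (2 * v 0)).re h1) (S.smul_mem (z / (2 * v 0)).im h2) using 1
    ext i
    simp only [Pi.add_apply, Pi.smul_apply, Complex.real_smul]
    fin_cases i
    · have h3 : z = z / (2 * v 0) * (2 * v 0) := by field_simp
      simp
      conv_lhs => rw [h3, ← Complex.re_add_im (z / (2 * v 0))]
      ring
    · simp
    · simp
  have hz : ∀ z : ℂ, ![z, 0, 0] ∈ S := by
    by_contra hn
    have hz0 : ∀ v ∈ S, v 0 = 0 := fun v hv => by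
      by_contra h; exact hn (hfirst v hv h)
    have hz1 : ∀ v ∈ S, v 1 = 0 := fun v hv => hz0 _ (hcyc v hv)
    have hz2 : ∀ v ∈ S, v 2 = 0 := fun v hv => hz1 _ (hcyc v hv)
    refine hv₀ (funext fun i => ?_)
    fin_cases i
    exacts [hz0 _ h₀, hz1 _ h₀, hz2 _ h₀]
  convert S.add_mem (S.add_mem (hz (w 0)) (hcyc _ (hcyc _ (hz (w 1))))) (hcyc _ (hz (w 2))) using 1
  ext i
  fin_cases i <;> simp

theorem isIrreducibleOn_SU3_Λ6 : IsIrreducibleOn (resSU3 (formRep 3)) Λ6 := by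
  refine isIrreducibleOn_iff.2 ⟨fun A _ h => formRep_mem_Λ6 A.1 h, Λ6_ne_bot,
    fun S hS hinv h0 => le_antisymm hS fun T hT => ?_⟩
  obtain ⟨T₀, hT₀, hne⟩ := Submodule.exists_mem_ne_zero_of_ne_bot h0
  obtain ⟨X₀, rfl⟩ := mem_Λ6.1 (hS hT₀)
  obtain ⟨X, rfl⟩ := mem_Λ6.1 hT
  have hX₀ : X₀ ≠ 0 := fun h => hne (by rw [h, map_zero])
  have := mem_of_mulVec_closed (S.comap (wedgeΩ ∘ₗ toC3ₗ.symm)) (fun g hg v hv => ?_)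
    (v₀ := toC3ₗ X₀) (toC3ₗ.map_ne_zero_iff.2 hX₀) ?_ (toC3ₗ X)
  · simpa using this
  · have h1 := hinv (ofSpecialUnitary g hg) _ hv
    change formRep 3 (ofSpecialUnitary g hg).1 (wedgeΩ (toC3ₗ.symm v)) ∈ S at h1
    rw [formRep_wedgeΩ] at h1
    have h2 : toC3ₗ.symm (g.mulVec v) = (ofSpecialUnitary g hg).1.1 (toC3ₗ.symm v) := by
      apply toC3_injective
      rw [toC3_symm, ofSpecialUnitary, ofUnitary_apply, toC3_matEnd, toC3_symm]
    change wedgeΩ (toC3ₗ.symm (g.mulVec v)) ∈ S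
    rwa [h2]
  · simpa using hT₀

/-- The `3`-form associated with an antilinear endomorphism of `ℂ³`. -/
def antiForm : Matrix (Fin 3) (Fin 3) ℂ →ₗ[ℝ] Form 3 where
  toFun B := act (antiEnd B) (psi 1)
  map_add' B C := by rw [map_add, act_add]
  map_smul' c B := by rw [map_smul, act_smul]; rfl

theorem antiForm_apply (B : Matrix (Fin 3) (Fin 3) ℂ) (u v w : E6) :
    antiForm B ![u, v, w] = psi 1 ![antiEnd B u, v, w] + psi 1 ![u, antiEnd B v, w] +
      psi 1 ![u, v, antiEnd B w] := act_apply _ _ _ _ _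

theorem formRep_antiForm {M : Matrix (Fin 3) (Fin 3) ℂ}
    (hM : M ∈ Matrix.specialUnitaryGroup (Fin 3) ℂ) (B : Matrix (Fin 3) (Fin 3) ℂ) :
    formRep 3 (ofSpecialUnitary M hM).1 (antiForm B) = antiForm (M * B * M.transpose) := by
  change formRep 3 _ (act _ _) = act _ _
  rw [formRep_act, formRep_psi, ofSpecialUnitary, conjEnd_ofUnitary_antiEnd]

theorem τ_antiForm (B : Matrix (Fin 3) (Fin 3) ℂ) :
    τ (antiForm B) = -formJ 3 (antiForm B) := by
  refine form_three_ext fun u v w => ?_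
  rw [τ_apply, AlternatingMap.neg_apply, formJ_apply_three]
  simp only [antiForm_apply, antiEnd_J, form_three_neg0, form_three_neg1, form_three_neg2,
    psi_J0, psi_J1, psi_J2]
  have : Complex.I * (Complex.I * (Complex.I * 1)) = -(Complex.I * 1) := by
    linear_combination Complex.I * Complex.I_mul_I
  rw [this, map_neg]
  simp only [AlternatingMap.neg_apply]
  ring

theorem kaehlerTrace_antiForm (v : Fin 6 → ℂ) : kaehlerTrace (antiForm (symMat v)) = 0 := by
  refine ext_inner_right ℝ fun x => ?_
  rw [inner_kaehlerTrace, inner_zero_left]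
  simp only [antiForm_apply, psi_apply, toC3_antiEnd, toC3_e0, toC3_e1, toC3_e2, toC3_e3, toC3_e4,
    toC3_e5, one_mul, ← Complex.add_re]
  rw [← Complex.zero_re]
  congr 1
  simp [det3, symMat_apply, Matrix.mulVec, dotProduct, Fin.sum_univ_three]
  ring

theorem antiForm_mem_Λ12 (v : Fin 6 → ℂ) : antiForm (symMat v) ∈ Λ12 :=
  mem_Λ12.2 ⟨τ_antiForm _, kaehlerTrace_antiForm v⟩

theorem antiForm_symMat_eq_zero {v : Fin 6 → ℂ} (h : antiForm (symMat v) = 0) : v = 0 := by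
  have key : ∀ i j k, antiForm (symMat v) ![e i, e j, e k] = 0 := fun i j k => by rw [h]; rfl
  have h1 := key 0 2 4
  have h2 := key 1 3 4
  have h3 := key 1 2 5
  have h4 := key 0 3 5
  have h5 := key 1 2 4
  have h6 := key 0 3 4
  have h7 := key 0 2 5
  have h8 := key 1 3 5
  have h9 := key 0 1 2
  have h10 := key 0 1 3
  have h11 := key 0 1 4
  have h12 := key 0 1 5
  have h13 := key 0 2 3
  have h14 := key 1 2 3
  simp [antiForm_apply, psi_apply, toC3_antiEnd, toC3_e0, toC3_e1, toC3_e2, toC3_e3, toC3_e4,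
    toC3_e5, det3, symMat_apply, Matrix.mulVec, dotProduct,
    Fin.sum_univ_three] at h1 h2 h3 h4 h5 h6 h7 h8 h9 h10 h11 h12 h13 h14
  refine funext fun i => Complex.ext ?_ ?_ <;> fin_cases i <;> simp <;> linarith

/-- The `3`-form associated with a complex symmetric matrix. -/
def symForm : (Fin 6 → ℂ) →ₗ[ℝ] Form 3 where
  toFun v := antiForm (symMat v)
  map_add' v w := by rw [map_add, map_add]
  map_smul' c v := by
    have : symMat (c • v) = c • symMat v := symMat.map_smul_of_tower c v
    rw [this, map_smul]; rfl

theorem range_symForm : LinearMap.range symForm = Λ12 := by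
  have hf : Function.Injective symForm := by
    rw [injective_iff_map_eq_zero]
    exact fun v hv => antiForm_symMat_eq_zero hv
  refine Submodule.eq_of_le_of_finrank_eq ?_ ?_
  · rintro _ ⟨v, rfl⟩
    exact antiForm_mem_Λ12 v
  · have h6 : Module.finrank ℝ (Fin 6 → ℂ) = 12 := by
      rw [Module.finrank_pi_fintype]
      simp [Complex.finrank_real_complex]
    rw [finrank_Λ12, ← h6]
    exact LinearMap.finrank_range_of_inj hf

theorem exists_antiForm_of_mem_Λ12 {T : Form 3} (hT : T ∈ Λ12) :
    ∃ v, antiForm (symMat v) = T := by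
  rw [← range_symForm] at hT
  exact hT

theorem isIrreducibleOn_SU3_Λ12 : IsIrreducibleOn (resSU3 (formRep 3)) Λ12 := by
  refine isIrreducibleOn_iff.2 ⟨fun A _ h => formRep_mem_Λ12 A.1 h, Λ12_ne_bot,
    fun S hS hinv h0 => le_antisymm hS fun T hT => ?_⟩
  have hclosed : ∀ g ∈ Matrix.specialUnitaryGroup (Fin 3) ℂ, ∀ B, antiForm B ∈ S →
      antiForm (g * B * g.transpose) ∈ S := fun g hg B hB => by
    rw [← formRep_antiForm hg]
    exact hinv (ofSpecialUnitary g hg) _ hB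
  have hI : ∀ B, antiForm B ∈ S → antiForm (Complex.I • B) ∈ S := fun B hB => by
    set r : ℝ := Real.sqrt 3 / 2 with hr
    have hr2 : (r : ℂ) * r = 3 / 4 := by
      rw [← Complex.ofReal_mul, hr, div_mul_div_comm, Real.mul_self_sqrt (by norm_num)]
      norm_num
    have hr0 : r ≠ 0 := by positivity
    set ω : ℂ := -1 / 2 + r * Complex.I with hω
    have hstar : star ω = -1 / 2 - r * Complex.I := by
      simp [hω, sub_eq_add_neg]
    have h1 : ω * star ω = 1 := by
      rw [hstar]
      linear_combination hr2 - r * r * Complex.I_mul_I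
    have h2 : ω * ω = star ω := by
      rw [hstar]
      linear_combination -hr2 + r * r * Complex.I_mul_I
    have h3 := hclosed _ (diagonal_mem_specialUnitary h1 h1 h1 (by rw [h2, mul_comm, h1])) B hB
    have h4 : !![ω, 0, 0; 0, ω, 0; 0, 0, ω] * B * (!![ω, 0, 0; 0, ω, 0; 0, 0, ω]).transpose =
        (-1 / 2 : ℝ) • B - r • (Complex.I • B) := by
      have h5 : !![ω, 0, 0; 0, ω, 0; 0, 0, ω] = ω • (1 : Matrix (Fin 3) (Fin 3) ℂ) := by
        ext i j; fin_cases i <;> fin_cases j <;> simp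
      rw [h5, Matrix.transpose_smul, Matrix.transpose_one, smul_mul_assoc, one_mul,
        Matrix.mul_smul, mul_one, smul_smul, h2, hstar]
      ext i j
      simp
      ring
    rw [h4, map_sub, map_smul, map_smul] at h3
    have h5 := S.smul_mem (-r⁻¹) (S.sub_mem h3 (S.smul_mem (-1 / 2 : ℝ) hB))
    convert h5 using 1
    rw [sub_sub_cancel_left, smul_neg, neg_smul, neg_neg, smul_smul, inv_mul_cancel₀ hr0, one_smul]
  let S' : Submodule ℂ (Matrix (Fin 3) (Fin 3) ℂ) :=
    { carrier := {B | antiForm B ∈ S}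
      zero_mem' := by
        change antiForm 0 ∈ S
        rw [map_zero]; exact S.zero_mem
      add_mem' := fun {B C} hB hC => by
        change antiForm (B + C) ∈ S
        rw [map_add]; exact S.add_mem hB hC
      smul_mem' := fun c B hB => by
        change antiForm (c • B) ∈ S
        have h1 : c • B = c.re • B + c.im • (Complex.I • B) := by
          conv_lhs => rw [← Complex.re_add_im c, add_smul, mul_smul]
          rfl
        rw [h1, map_add, map_smul, map_smul]
        exact S.add_mem (S.smul_mem _ hB) (S.smul_mem _ (hI _ hB)) }
  obtain ⟨T₀, hT₀, hne⟩ := Submodule.exists_mem_ne_zero_of_ne_bot h0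
  obtain ⟨v₀, rfl⟩ := exists_antiForm_of_mem_Λ12 (hS hT₀)
  obtain ⟨v, rfl⟩ := exists_antiForm_of_mem_Λ12 hT
  exact symMat_mem_of_congr_closed S' (fun g hg v hv => hclosed g hg _ hv)
    (v₀ := v₀) (fun h => hne (by rw [h, map_zero, map_zero])) hT₀ v

/-! ### The tensor product `ℝ⁶ ⊗ 𝔪` -/

/-- The tensor `∑ᵢ eᵢ ⊗ F(eᵢ)` associated with a linear map. -/
def homTensor : (E6 →ₗ[ℝ] M6) →ₗ[ℝ] E6 ⊗[ℝ] M6 where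
  toFun F := ∑ i, e i ⊗ₜ[ℝ] F (e i)
  map_add' F G := by
    simp only [LinearMap.add_apply, TensorProduct.tmul_add, Finset.sum_add_distrib]
  map_smul' c F := by
    simp only [LinearMap.smul_apply, TensorProduct.tmul_smul, Finset.smul_sum, RingHom.id_apply]

theorem homTensor_apply (F : E6 →ₗ[ℝ] M6) : homTensor F = ∑ i, e i ⊗ₜ[ℝ] F (e i) := rfl

theorem homTensor_injective : Function.Injective homTensor := by
  intro F G h
  refine (EuclideanSpace.basisFun (Fin 6) ℝ).toBasis.ext fun j => ?_
  let c : E6 ⊗[ℝ] M6 →ₗ[ℝ] M6 :=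
    TensorProduct.lid ℝ M6 ∘ₗ LinearMap.rTensor M6 (innerₗ E6 (e j))
  have hc : ∀ F, c (homTensor F) = F (e j) := fun F => by
    rw [homTensor_apply, map_sum]
    simp [c, inner_e_left, e_apply]
  rw [OrthonormalBasis.coe_toBasis, EuclideanSpace.basisFun_apply]
  exact (hc F).symm.trans ((congrArg c h).trans (hc G))

theorem tensorRep_homTensor (A : U3) (F : E6 →ₗ[ℝ] M6) :
    tensorRep A (homTensor F) = homTensor (mSub.toRepresentation A ∘ₗ F ∘ₗ stdRep A⁻¹) := by
  let B : E6 →ₗ[ℝ] E6 →ₗ[ℝ] E6 ⊗[ℝ] M6 :=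
    (TensorProduct.mk ℝ E6 M6).compl₂ (mSub.toRepresentation A ∘ₗ F ∘ₗ stdRep A⁻¹)
  rw [homTensor_apply, homTensor_apply, map_sum]
  refine Eq.trans ?_ (sum_map_U3 B A)
  refine Finset.sum_congr rfl fun i _ => ?_
  change A.1 (e i) ⊗ₜ[ℝ] mSub.toRepresentation A (F (e i)) =
    A.1 (e i) ⊗ₜ[ℝ] mSub.toRepresentation A (F ((A⁻¹).1 (A.1 (e i))))
  rw [U3_inv_apply]

theorem Φ_tmul (X : E6) (m : M6) : Φ (X ⊗ₜ[ℝ] m) = wedge (innerₗ E6 X) m.1 := rfl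

theorem Φ_homTensor (F : E6 →ₗ[ℝ] M6) (u v w : E6) :
    Φ (homTensor F) ![u, v, w] = (F u).1 ![v, w] - (F v).1 ![u, w] + (F w).1 ![u, v] := by
  have h := sum_wedge_contract_apply LinearMap.id (mSub.toSubmodule.subtype ∘ₗ F) u v w
  rw [homTensor_apply, map_sum]
  exact h

theorem Φ_tensorRep (A : U3) (x : E6 ⊗[ℝ] M6) : Φ (tensorRep A x) = formRep 3 A (Φ x) := by
  induction x using TensorProduct.induction_on with
  | zero => simp only [map_zero]
  | add x y hx hy => simp only [map_add, hx, hy]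
  | tmul X m =>
    change Φ (A.1 X ⊗ₜ[ℝ] mSub.toRepresentation A m) = _
    rw [Φ_tmul, Φ_tmul]
    refine form_three_ext fun u v w => ?_
    have h : ∀ u v, (mSub.toRepresentation A m).1 ![u, v] = m.1 ![(A⁻¹).1 u, (A⁻¹).1 v] :=
      formRep_apply_two A m.1
    rw [formRep_apply_three, wedge_apply_three, wedge_apply_three]
    simp only [h, innerₗ_apply_apply, U3_inner_left]

theorem prM_coe (ω : Form 2) : (prM ω).1 = (1 / 2 : ℝ) • (ω - formJ 2 ω) := rfl

theorem prM_formRep (A : U3) (ω : Form 2) :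
    prM (formRep 2 A ω) = mSub.toRepresentation A (prM ω) := by
  refine Subtype.ext ?_
  change _ = formRep 2 A (prM ω).1
  rw [prM_coe, prM_coe, map_smul, map_sub, formJ_formRep]

theorem Θ_eq_homTensor (T : Form 3) : Θ T = homTensor (prM ∘ₗ contractₗ T) := by
  rw [Θ, LinearMap.sum_apply]; rfl

theorem Θ_formRep (A : U3) (T : Form 3) : Θ (formRep 3 A T) = tensorRep A (Θ T) := by
  rw [Θ_eq_homTensor, Θ_eq_homTensor, tensorRep_homTensor]
  congr 1
  ext1 x
  change prM (contract x (formRep 3 A T)) =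
    mSub.toRepresentation A (prM (contract ((A⁻¹).1 x) T))
  rw [← prM_formRep, formRep_contract, U3_apply_inv]

theorem Φ_Θ (T : Form 3) : Φ (Θ T) = (1 / 2 : ℝ) • ((3 : ℝ) • T - formJ 3 (τ T)) := by
  refine form_three_ext fun u v w => ?_
  rw [Θ_eq_homTensor, Φ_homTensor]
  simp only [LinearMap.comp_apply, prM_coe, contractₗ_apply, AlternatingMap.smul_apply,
    AlternatingMap.sub_apply, formJ_apply_two, contract_apply_two, formJ_apply_three, τ_apply,
    J_J, form_three_neg0, form_three_neg1, form_three_neg2, smul_eq_mul]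
  rw [form_three_swap01 T v u w, form_three_rot T w u v, form_three_rot T u v w,
    form_three_rot T v w u, form_three_swap01 T v (J u) (J w), form_three_rot T w (J u) (J v)]
  ring

theorem Φ_Θ_of_mem_Λ2 {T : Form 3} (h : T ∈ Λ2) : Φ (Θ T) = (3 : ℝ) • T := by
  rw [Φ_Θ, mem_Λ2.1 h, map_smul, formJ_formJ_three]; module

theorem Φ_Θ_of_τ {T : Form 3} (h : τ T = -formJ 3 T) : Φ (Θ T) = T := by
  rw [Φ_Θ, h, map_neg, formJ_formJ_three]; module

theorem Φ_Θ_of_mem_Λ6 {T : Form 3} (h : T ∈ Λ6) : Φ (Θ T) = T := Φ_Θ_of_τ (τ_of_mem_Λ6 h)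

theorem Φ_Θ_of_mem_Λ12 {T : Form 3} (h : T ∈ Λ12) : Φ (Θ T) = T := Φ_Θ_of_τ (mem_Λ12.1 h).1

theorem Θ_injective : Function.Injective Θ := by
  rw [injective_iff_map_eq_zero]
  intro T hT
  obtain ⟨a, ha, b, hb, c, hc, rfl⟩ := exists_Λ_decomposition T
  have h := congrArg Φ hT
  rw [map_add, map_add, map_add, map_add, Φ_Θ_of_mem_Λ2 ha, Φ_Θ_of_mem_Λ6 hb,
    Φ_Θ_of_mem_Λ12 hc, map_zero] at h
  obtain ⟨h1, rfl, rfl⟩ := Λ_sum_eq_zero (Λ2.smul_mem 3 ha) hb hc h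
  rw [(smul_eq_zero.1 h1).resolve_left three_ne_zero, add_zero, add_zero]

theorem exists_W_decomposition (x : E6 ⊗[ℝ] M6) :
    ∃ a ∈ W1, ∃ b ∈ W2, ∃ c ∈ W3, ∃ d ∈ W4, a + b + c + d = x := by
  obtain ⟨a, ha, d, hd, c, hc, h⟩ := exists_Λ_decomposition (Φ x)
  refine ⟨Θ ((1 / 3 : ℝ) • a), ⟨_, Λ2.smul_mem _ ha, rfl⟩,
    x - Θ ((1 / 3 : ℝ) • a) - Θ c - Θ d, ?_, Θ c, ⟨c, hc, rfl⟩, Θ d, ⟨d, hd, rfl⟩, by abel⟩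
  change Φ _ = 0
  rw [map_sub, map_sub, map_sub, Φ_Θ_of_mem_Λ2 (Λ2.smul_mem _ ha), Φ_Θ_of_mem_Λ6 hd,
    Φ_Θ_of_mem_Λ12 hc, ← h]
  module

theorem W_sum_eq_zero {a b c d : E6 ⊗[ℝ] M6} (ha : a ∈ W1) (hb : b ∈ W2) (hc : c ∈ W3)
    (hd : d ∈ W4) (h : a + b + c + d = 0) : a = 0 ∧ b = 0 ∧ c = 0 ∧ d = 0 := by
  obtain ⟨a, ha, rfl⟩ := ha
  obtain ⟨c, hc, rfl⟩ := hc
  obtain ⟨d, hd, rfl⟩ := hd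
  have hb' : Φ b = 0 := hb
  have h1 := congrArg Φ h
  rw [map_add, map_add, map_add, Φ_Θ_of_mem_Λ2 ha, hb', Φ_Θ_of_mem_Λ6 hd, Φ_Θ_of_mem_Λ12 hc,
    map_zero, add_zero, add_right_comm] at h1
  obtain ⟨h2, rfl, rfl⟩ := Λ_sum_eq_zero (Λ2.smul_mem 3 ha) hd hc h1
  obtain rfl := (smul_eq_zero.1 h2).resolve_left three_ne_zero
  simp only [map_zero, zero_add, add_zero] at h ⊢
  exact ⟨trivial, h, trivial, trivial⟩

theorem isInternal_W : DirectSum.IsInternal ![W1, W2, W3, W4] := by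
  refine isInternal_of_existsUnique_sum _ (fun T => ?_) fun f hf h => ?_
  · obtain ⟨a, ha, b, hb, c, hc, d, hd, h⟩ := exists_W_decomposition T
    refine ⟨![a, b, c, d], fun i => ?_, ?_⟩
    · fin_cases i
      exacts [ha, hb, hc, hd]
    · rw [Fin.sum_univ_four]; exact h
  · rw [Fin.sum_univ_four] at h
    have := W_sum_eq_zero (hf 0) (hf 1) (hf 2) (hf 3) h
    intro i; fin_cases i
    exacts [this.1, this.2.1, this.2.2.1, this.2.2.2]

theorem finrank_map_Θ (W : Submodule ℝ (Form 3)) :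
    Module.finrank ℝ (W.map Θ) = Module.finrank ℝ W :=
  (Submodule.equivMapOfInjective Θ Θ_injective W).finrank_eq.symm

theorem isIrreducibleOn_map_Θ {W : Submodule ℝ (Form 3)} (h : IsIrreducibleOn (formRep 3) W) :
    IsIrreducibleOn tensorRep (W.map Θ) :=
  h.map Θ Θ_formRep fun _ _ hv => Θ_injective (hv.trans (map_zero Θ).symm)

/-! ### The space `𝒲₂` -/

/-- The map `Y ↦ Y ⌟ Re(dz₁ ∧ dz₂ ∧ dz₃)` to `𝔪`. -/
def psiM : E6 →ₗ[ℝ] M6 :=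
  LinearMap.codRestrict mSub.toSubmodule (contractₗ (psi 1)) fun Y => by
    rw [mSub, LinearMap.mem_ker]
    refine form_two_ext fun u v => ?_
    change formJ 2 (contract Y (psi 1)) ![u, v] + contract Y (psi 1) ![u, v] = 0
    rw [formJ_apply_two, contract_apply_two, contract_apply_two, psi_J1, psi_J2]
    have : Complex.I * (Complex.I * 1) = -1 := by linear_combination Complex.I_mul_I
    rw [this, map_neg, AlternatingMap.neg_apply]
    ring

theorem psiM_coe (Y : E6) : (psiM Y).1 = contract Y (psi 1) := rfl

theorem psiM_injective : Function.Injective psiM := by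
  rw [injective_iff_map_eq_zero]
  intro Y hY
  have key : ∀ i j, psi 1 ![Y, e i, e j] = 0 := fun i j => by
    rw [← contract_apply_two, ← psiM_coe, hY]; rfl
  have h1 := key 2 4
  have h2 := key 3 4
  have h3 := key 0 4
  have h4 := key 1 4
  have h5 := key 0 2
  have h6 := key 1 2
  simp only [psi_apply, toC3_e0, toC3_e1, toC3_e2, toC3_e3, toC3_e4] at h1 h2 h3 h4 h5 h6
  simp [det3, toC3] at h1 h2 h3 h4 h5 h6
  ext i
  fin_cases i
  exacts [h1, h2, h3, h4, h5, h6]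

/-- The element `∑ᵢ eᵢ ⊗ (L eᵢ ⌟ Re(dz₁ ∧ dz₂ ∧ dz₃))` associated with an endomorphism `L`. -/
def endTensor : (E6 →ₗ[ℝ] E6) →ₗ[ℝ] E6 ⊗[ℝ] M6 where
  toFun L := homTensor (psiM ∘ₗ L)
  map_add' L M := by rw [LinearMap.comp_add, map_add]
  map_smul' c L := by rw [LinearMap.comp_smul, map_smul]; rfl

theorem endTensor_apply (L : E6 →ₗ[ℝ] E6) : endTensor L = homTensor (psiM ∘ₗ L) := rfl

theorem endTensor_injective : Function.Injective endTensor := fun _ _ h =>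
  LinearMap.ext fun x => psiM_injective (LinearMap.congr_fun (homTensor_injective h) x)

theorem Φ_endTensor (L : E6 →ₗ[ℝ] E6) : Φ (endTensor L) = act L (psi 1) := by
  refine form_three_ext fun u v w => ?_
  rw [endTensor_apply, Φ_homTensor, act_apply]
  simp only [LinearMap.comp_apply, psiM_coe, contract_apply_two]
  rw [form_three_swap01 _ u (L v), ← form_three_rot _ (L w) u v]
  ring

theorem tensorRep_endTensor (A : SU3) (L : E6 →ₗ[ℝ] E6) :
    tensorRep A.1 (endTensor L) = endTensor (conjEnd A.1 L) := by
  rw [endTensor_apply, endTensor_apply, tensorRep_homTensor]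
  congr 1
  ext1 x
  refine Subtype.ext ?_
  change formRep 2 A.1 (contract (L ((A.1⁻¹).1 x)) (psi 1)) =
    contract (A.1.1 (L ((A.1⁻¹).1 x))) (psi 1)
  rw [formRep_contract, formRep_psi]

theorem contract_psi_I (Y : E6) : contract Y (psi Complex.I) = contract (J Y) (psi 1) :=
  form_two_ext fun u v => by
    rw [contract_apply_two, contract_apply_two, psi_J0, mul_one]

theorem tensorRep_jU_endTensor (M : Matrix (Fin 3) (Fin 3) ℂ) :
    tensorRep jU (endTensor (matEnd M)) = endTensor (matEnd (Complex.I • M)) := by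
  rw [endTensor_apply, endTensor_apply, tensorRep_homTensor]
  congr 1
  ext1 x
  refine Subtype.ext ?_
  change formRep 2 jU (contract (matEnd M ((jU⁻¹).1 x)) (psi 1)) =
    contract (matEnd (Complex.I • M) x) (psi 1)
  rw [formRep_contract, formRep_jU, formJ_psi, ← map_neg, mul_one, neg_neg, contract_psi_I,
    jU_apply, jU_inv_apply, map_neg, matEnd_J, map_neg, J_J, neg_neg, matEnd_I_smul]
  rfl

theorem matEnd_injective : Function.Injective matEnd := by
  rw [injective_iff_map_eq_zero]
  intro M hM
  have h : ∀ v, M.mulVec v = 0 := fun v => by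
    have h1 := congrArg toC3 (LinearMap.congr_fun hM (toC3ₗ.symm v))
    rw [toC3_matEnd, toC3_symm] at h1
    exact h1.trans toC3ₗ.map_zero
  ext i j
  simpa using congrFun (h (Pi.single j 1)) i

theorem endTensor_matEnd_mem_W2 {M : Matrix (Fin 3) (Fin 3) ℂ} (h : M.trace = 0) :
    endTensor (matEnd M) ∈ W2 := by
  change Φ _ = 0
  rw [Φ_endTensor, act_matEnd_psi, h, zero_mul, map_zero]

theorem finrank_M6_le : Module.finrank ℝ M6 ≤ 6 := by
  let f : M6 →ₗ[ℝ] (Fin 6 → ℝ) :=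
    { toFun := fun ω => ![ω.1 ![e 0, e 2], ω.1 ![e 1, e 2], ω.1 ![e 0, e 4], ω.1 ![e 1, e 4],
        ω.1 ![e 2, e 4], ω.1 ![e 3, e 4]]
      map_add' := fun ω η => by ext i; fin_cases i <;> rfl
      map_smul' := fun c ω => by ext i; fin_cases i <;> rfl }
  have hf : Function.Injective f := by
    rw [injective_iff_map_eq_zero]
    intro ω hω
    have hJJ : ∀ u v, ω.1 ![J u, J v] = -ω.1 ![u, v] := fun u v => by
      have h1 : formJ 2 ω.1 + ω.1 = 0 := ω.2
      have h2 := congrArg (fun η : Form 2 => η ![u, v]) h1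
      simp only [AlternatingMap.add_apply, formJ_apply_two, AlternatingMap.zero_apply] at h2
      linarith
    have hJ : ∀ u v, ω.1 ![u, J v] = ω.1 ![J u, v] := fun u v => by
      have := hJJ (J u) v
      rw [J_J, form_two_neg0] at this
      linarith
    have h0 : ω.1 ![e 0, e 2] = 0 := congrFun hω 0
    have h1 : ω.1 ![J (e 0), e 2] = 0 := by rw [J_e0]; exact congrFun hω 1
    have h2 : ω.1 ![e 0, e 4] = 0 := congrFun hω 2
    have h3 : ω.1 ![J (e 0), e 4] = 0 := by rw [J_e0]; exact congrFun hω 3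
    have h4 : ω.1 ![e 2, e 4] = 0 := congrFun hω 4
    have h5 : ω.1 ![J (e 2), e 4] = 0 := by rw [J_e2]; exact congrFun hω 5
    have hs : ∀ u, ω.1 ![J u, u] = 0 := fun u => by
      have := hJ u u
      rw [form_two_swap] at this
      linarith
    refine Subtype.ext (form_two_ext_e fun i j => ?_)
    change ω.1 ![e i, e j] = 0
    have hlt : ∀ i j : Fin 6, i < j → ω.1 ![e i, e j] = 0 := by
      intro i j hij
      fin_cases i <;> fin_cases j <;> first | exact absurd hij (by decide) | skip
      all_goals simp [← J_e0, ← J_e2, ← J_e4, hJ, hs, J_J, form_two_neg0, h0, h1, h2, h3, h4, h5]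
    rcases lt_trichotomy i j with h | rfl | h
    · exact hlt i j h
    · exact form_two_self _ _
    · rw [form_two_swap, hlt j i h, neg_zero]
  simpa using LinearMap.finrank_le_finrank_of_injective hf

theorem Φ_surjective : Function.Surjective Φ := fun T => by
  obtain ⟨a, ha, b, hb, c, hc, rfl⟩ := exists_Λ_decomposition T
  refine ⟨Θ ((1 / 3 : ℝ) • a + b + c), ?_⟩
  rw [map_add, map_add, map_add, map_add, Φ_Θ_of_mem_Λ2 (Λ2.smul_mem _ ha), Φ_Θ_of_mem_Λ6 hb,
    Φ_Θ_of_mem_Λ12 hc]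
  module

theorem finrank_W2_le : Module.finrank ℝ W2 ≤ 16 := by
  have h1 := LinearMap.finrank_range_add_finrank_ker Φ
  have h2 : Module.finrank ℝ (E6 ⊗[ℝ] M6) = Module.finrank ℝ E6 * Module.finrank ℝ M6 :=
    Module.finrank_tensorProduct
  rw [LinearMap.range_eq_top.2 Φ_surjective, finrank_top, finrank_form, h2,
    finrank_euclideanSpace_fin] at h1
  have h3 := finrank_M6_le
  have h4 : Nat.choose 6 3 = 20 := rfl
  change Module.finrank ℝ (LinearMap.ker Φ) ≤ 16
  omega

/-- The complex `3 × 3` matrices of trace zero, as a real vector space. -/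
def slMat : Submodule ℝ (Matrix (Fin 3) (Fin 3) ℂ) :=
  LinearMap.ker (Matrix.traceLinearMap (Fin 3) ℝ ℂ)

theorem finrank_slMat : Module.finrank ℝ slMat = 16 := by
  have h1 := LinearMap.finrank_range_add_finrank_ker (Matrix.traceLinearMap (Fin 3) ℝ ℂ)
  have h2 : LinearMap.range (Matrix.traceLinearMap (Fin 3) ℝ ℂ) = ⊤ := by
    refine LinearMap.range_eq_top.2 fun c => ⟨Matrix.single 0 0 c, ?_⟩
    simp
  rw [h2, finrank_top, Complex.finrank_real_complex, Module.finrank_matrix,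
    Complex.finrank_real_complex] at h1
  change Module.finrank ℝ (LinearMap.ker (Matrix.traceLinearMap (Fin 3) ℝ ℂ)) = 16
  simp at h1
  omega

theorem map_slMat : slMat.map (endTensor ∘ₗ matEnd) = W2 := by
  have hinj : Function.Injective (endTensor ∘ₗ matEnd) :=
    endTensor_injective.comp matEnd_injective
  have hle : slMat.map (endTensor ∘ₗ matEnd) ≤ W2 := by
    rintro _ ⟨M, hM, rfl⟩
    exact endTensor_matEnd_mem_W2 hM
  refine Submodule.eq_of_le_of_finrank_le hle ?_
  rw [← (Submodule.equivMapOfInjective _ hinj slMat).finrank_eq, finrank_slMat]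
  exact finrank_W2_le

theorem finrank_W2 : Module.finrank ℝ W2 = 16 := by
  have hinj : Function.Injective (endTensor ∘ₗ matEnd) :=
    endTensor_injective.comp matEnd_injective
  rw [← map_slMat, ← (Submodule.equivMapOfInjective _ hinj slMat).finrank_eq, finrank_slMat]

theorem tensorRep_mem_W2 (A : U3) {x : E6 ⊗[ℝ] M6} (h : x ∈ W2) : tensorRep A x ∈ W2 := by
  have h' : Φ x = 0 := h
  change Φ _ = 0
  rw [Φ_tensorRep, h', map_zero]

theorem exists_matrix_of_mem_W2 {x : E6 ⊗[ℝ] M6} (h : x ∈ W2) :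
    ∃ M : Matrix (Fin 3) (Fin 3) ℂ, M.trace = 0 ∧ endTensor (matEnd M) = x := by
  rw [← map_slMat] at h
  exact h

theorem isIrreducibleOn_W2 : IsIrreducibleOn tensorRep W2 := by
  refine isIrreducibleOn_iff.2 ⟨fun A _ h => tensorRep_mem_W2 A h, fun h => ?_,
    fun S hS hinv h0 => le_antisymm hS fun x hx => ?_⟩
  · have := finrank_W2
    rw [h, finrank_bot] at this
    omega
  let f : Matrix (Fin 3) (Fin 3) ℂ →ₗ[ℝ] E6 ⊗[ℝ] M6 := endTensor ∘ₗ matEnd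
  have hI : ∀ M, f M ∈ S → f (Complex.I • M) ∈ S := fun M hM => by
    have := hinv jU _ hM
    change tensorRep jU (endTensor (matEnd M)) ∈ S at this
    rwa [tensorRep_jU_endTensor] at this
  let S' : Submodule ℂ (Matrix (Fin 3) (Fin 3) ℂ) :=
    { carrier := {M | M.trace = 0 ∧ f M ∈ S}
      zero_mem' := ⟨Matrix.trace_zero _ _, by rw [map_zero]; exact S.zero_mem⟩
      add_mem' := fun {M N} hM hN => ⟨by rw [Matrix.trace_add, hM.1, hN.1, add_zero], by
        rw [map_add]; exact S.add_mem hM.2 hN.2⟩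
      smul_mem' := fun c M hM => ⟨by rw [Matrix.trace_smul, hM.1, smul_zero], by
        have h1 : c • M = c.re • M + c.im • (Complex.I • M) := by
          conv_lhs => rw [← Complex.re_add_im c, add_smul, mul_smul]
          rfl
        rw [h1, map_add, map_smul, map_smul]
        exact S.add_mem (S.smul_mem _ hM.2) (S.smul_mem _ (hI _ hM.2))⟩ }
  obtain ⟨x₀, hx₀, hne⟩ := Submodule.exists_mem_ne_zero_of_ne_bot h0
  obtain ⟨M₀, hM₀, rfl⟩ := exists_matrix_of_mem_W2 (hS hx₀)
  obtain ⟨M, hM, rfl⟩ := exists_matrix_of_mem_W2 hx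
  refine (mem_of_conj_closed S' (fun M hM => hM.1) (fun g hg M hM => ⟨?_, ?_⟩) (M₀ := M₀)
    (fun h => hne (by rw [h, map_zero, map_zero])) ⟨hM₀, hx₀⟩ hM).2
  · rw [Matrix.trace_mul_comm, ← mul_assoc,
      Matrix.mem_unitaryGroup_iff'.1 (Matrix.mem_specialUnitaryGroup_iff.1 hg).1, one_mul, hM.1]
  · have h1 := hinv (ofSpecialUnitary g hg).1 _ hM.2
    change tensorRep _ (endTensor (matEnd M)) ∈ S at h1
    rwa [tensorRep_endTensor, ofSpecialUnitary, conjEnd_ofUnitary_matEnd] at h1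

/-! ### Two-forms as skew-symmetric endomorphisms -/

/-- The endomorphism `ω♯` with `⟨ω♯ u, v⟩ = ω(u, v)`. -/
def sharp : Form 2 →ₗ[ℝ] E6 →ₗ[ℝ] E6 :=
  LinearMap.mk₂ ℝ (fun ω u => ∑ j, ω ![u, e j] • e j)
    (fun ω η u => by simp only [AlternatingMap.add_apply, add_smul, Finset.sum_add_distrib])
    (fun c ω u => by
      simp only [AlternatingMap.smul_apply, smul_eq_mul, mul_smul, Finset.smul_sum])
    (fun ω u v => by simp only [form_two_add0, add_smul, Finset.sum_add_distrib])
    (fun c ω u => by simp only [form_two_smul0, mul_smul, Finset.smul_sum])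

theorem inner_sharp (ω : Form 2) (u v : E6) : ⟪sharp ω u, v⟫_ℝ = ω ![u, v] := by
  let α : E6 →ₗ[ℝ] ℝ :=
    { toFun := fun v => ω ![u, v]
      map_add' := fun a b => form_two_add1 ω a b u
      map_smul' := fun c v => form_two_smul1 ω c v u }
  change ⟪∑ j, ω ![u, e j] • e j, v⟫_ℝ = α v
  rw [← sum_inner_smul_map α v, sum_inner]
  refine Finset.sum_congr rfl fun j _ => ?_
  rw [real_inner_smul_left, smul_eq_mul, mul_comm]
  rfl

theorem sharp_formRep (A : U3) (ω : Form 2) : sharp (formRep 2 A ω) = conjEnd A (sharp ω) := by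
  ext1 u
  refine ext_inner_right ℝ fun v => ?_
  rw [inner_sharp, formRep_apply_two, conjEnd_apply, U3_inner_left, inner_sharp]

theorem conjEnd_J_comp (A : U3) (L : E6 →ₗ[ℝ] E6) : conjEnd A (J ∘ₗ L) = J ∘ₗ conjEnd A L := by
  ext1 u
  exact U3_comm_J A _

theorem su3_J_J {ω : Form 2} (h : ω ∈ su3) (u v : E6) : ω ![J u, J v] = ω ![u, v] := by
  rw [← formJ_apply_two, h.1]

theorem su3_J {ω : Form 2} (h : ω ∈ su3) (u v : E6) : ω ![J u, v] = -ω ![u, J v] := by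
  rw [← su3_J_J h (J u) v, J_J, form_two_neg0]

theorem sum_form_J (ω : Form 2) : ∑ i, ω ![e i, J (e i)] =
    2 * (ω ![e 0, e 1] + ω ![e 2, e 3] + ω ![e 4, e 5]) := by
  simp only [Fin.sum_univ_six, J_e0, J_e1, J_e2, J_e3, J_e4, J_e5, form_two_neg1]
  rw [form_two_swap ω (e 1), form_two_swap ω (e 3), form_two_swap ω (e 5)]
  ring

theorem formRep_mem_su3 (A : U3) {ω : Form 2} (h : ω ∈ su3) : formRep 2 A ω ∈ su3 := by
  refine ⟨by rw [formJ_formRep, h.1], mul_left_cancel₀ (two_ne_zero (α := ℝ)) ?_⟩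
  rw [← sum_form_J, ← h.2, ← sum_form_J]
  let B : E6 →ₗ[ℝ] E6 →ₗ[ℝ] ℝ := LinearMap.mk₂ ℝ (fun u v => ω ![u, J v])
    (fun u v w => form_two_add0 ω u v _) (fun c u v => form_two_smul0 ω c u _)
    (fun u v w => by rw [map_add, form_two_add1])
    (fun c u v => by rw [map_smul, form_two_smul1, smul_eq_mul])
  refine Eq.trans (Finset.sum_congr rfl fun i _ => ?_) (sum_map_U3 B A⁻¹)
  rw [formRep_apply_two, U3_comm_J]
  rfl

theorem exists_matEnd_eq {L : E6 →ₗ[ℝ] E6} (h : ∀ x, L (J x) = J (L x)) :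
    ∃ M, matEnd M = L := by
  let M : Matrix (Fin 3) (Fin 3) ℂ := Matrix.of fun i j =>
    ![toC3 (L (e 0)) i, toC3 (L (e 2)) i, toC3 (L (e 4)) i] j
  have h0 : matEnd M (e 0) = L (e 0) := by
    apply toC3_injective
    rw [toC3_matEnd, toC3_e0]
    ext i
    simp [M, Matrix.mulVec, dotProduct, Fin.sum_univ_three]
  have h2 : matEnd M (e 2) = L (e 2) := by
    apply toC3_injective
    rw [toC3_matEnd, toC3_e2]
    ext i
    simp [M, Matrix.mulVec, dotProduct, Fin.sum_univ_three]
  have h4 : matEnd M (e 4) = L (e 4) := by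
    apply toC3_injective
    rw [toC3_matEnd, toC3_e4]
    ext i
    simp [M, Matrix.mulVec, dotProduct, Fin.sum_univ_three]
  refine ⟨M, linearMap_ext_e fun i => ?_⟩
  fin_cases i
  · exact h0
  · change matEnd M (e 1) = L (e 1); rw [← J_e0, matEnd_J, h, h0]
  · exact h2
  · change matEnd M (e 3) = L (e 3); rw [← J_e2, matEnd_J, h, h2]
  · exact h4
  · change matEnd M (e 5) = L (e 5); rw [← J_e4, matEnd_J, h, h4]

theorem trace_eq (M : Matrix (Fin 3) (Fin 3) ℂ) : M.trace =
    ⟨⟪matEnd M (e 0), e 0⟫_ℝ + ⟪matEnd M (e 2), e 2⟫_ℝ + ⟪matEnd M (e 4), e 4⟫_ℝ,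
      ⟪matEnd M (e 0), e 1⟫_ℝ + ⟪matEnd M (e 2), e 3⟫_ℝ + ⟪matEnd M (e 4), e 5⟫_ℝ⟩ := by
  have h0 : M 0 0 = toC3 (matEnd M (e 0)) 0 := by
    rw [toC3_matEnd, toC3_e0]; simp [Matrix.mulVec, dotProduct, Fin.sum_univ_three]
  have h1 : M 1 1 = toC3 (matEnd M (e 2)) 1 := by
    rw [toC3_matEnd, toC3_e2]; simp [Matrix.mulVec, dotProduct, Fin.sum_univ_three]
  have h2 : M 2 2 = toC3 (matEnd M (e 4)) 2 := by
    rw [toC3_matEnd, toC3_e4]; simp [Matrix.mulVec, dotProduct, Fin.sum_univ_three]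
  rw [Matrix.trace_fin_three, h0, h1, h2]
  simp only [inner_e_right]
  rfl

theorem exists_matEnd_sharp {ω : Form 2} (h : ω ∈ su3) :
    ∃ M, matEnd M = sharp ω ∧ M.trace = 0 := by
  obtain ⟨M, hM⟩ := exists_matEnd_eq (L := sharp ω) fun x => ext_inner_right ℝ fun v => by
    rw [inner_sharp, inner_J_left, inner_sharp, su3_J h]
  refine ⟨M, hM, ?_⟩
  rw [trace_eq, hM]
  simp only [inner_sharp, form_two_self, h.2, add_zero]
  rfl

/-- The skew-symmetric part of an endomorphism, as a two-form. -/
def skewForm (L : E6 →ₗ[ℝ] E6) : Form 2 where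
  toFun v := (1 / 2 : ℝ) * (⟪L (v 0), v 1⟫_ℝ - ⟪v 0, L (v 1)⟫_ℝ)
  map_update_add' v i x y := by
    fin_cases i <;> simp [Function.update, inner_add_left, inner_add_right] <;> ring
  map_update_smul' v i c x := by
    fin_cases i <;> simp [Function.update, inner_smul_left, inner_smul_right] <;> ring
  map_eq_zero_of_eq' v i j h hij := by
    have h01 : v 0 = v 1 := by
      fin_cases i <;> fin_cases j <;> first | exact absurd rfl hij | exact h | exact h.symm
    rw [h01, real_inner_comm, sub_self, mul_zero]

theorem skewForm_apply (L : E6 →ₗ[ℝ] E6) (u v : E6) :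
    skewForm L ![u, v] = (1 / 2 : ℝ) * (⟪L u, v⟫_ℝ - ⟪u, L v⟫_ℝ) := rfl

theorem skewForm_matEnd_mem_su3 {M : Matrix (Fin 3) (Fin 3) ℂ} (h : M.trace = 0) :
    skewForm (matEnd M) ∈ su3 := by
  have key : ∀ u, skewForm (matEnd M) ![u, J u] = ⟪matEnd M u, J u⟫_ℝ := fun u => by
    rw [skewForm_apply, matEnd_J, real_inner_comm, inner_J_left]
    ring
  refine ⟨form_two_ext fun u v => ?_, ?_⟩
  · rw [formJ_apply_two, skewForm_apply, skewForm_apply, matEnd_J, matEnd_J, inner_J_J, inner_J_J]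
  · have h1 := congrArg Complex.im h
    rw [trace_eq] at h1
    rw [← J_e0, ← J_e2, ← J_e4, key, key, key, J_e0, J_e2, J_e4]
    exact h1

theorem sharp_skewForm_add (M : Matrix (Fin 3) (Fin 3) ℂ) :
    sharp (skewForm (matEnd M)) + J ∘ₗ sharp (skewForm (matEnd (-Complex.I • M))) = matEnd M := by
  ext1 u
  refine ext_inner_right ℝ fun v => ?_
  rw [LinearMap.add_apply, LinearMap.comp_apply, inner_add_left, inner_J_left, inner_sharp,
    inner_sharp, skewForm_apply, skewForm_apply, neg_smul, map_neg, matEnd_I_smul]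
  simp only [LinearMap.neg_apply, LinearMap.comp_apply, matEnd_J, J_J, inner_neg_left,
    inner_neg_right, inner_J_J]
  ring

/-- The map `(ω, η) ↦ ∑ᵢ eᵢ ⊗ ((ω♯ + J η♯) eᵢ ⌟ Re(dz₁ ∧ dz₂ ∧ dz₃))`. -/
def su3ToTensor : su3 × su3 →ₗ[ℝ] E6 ⊗[ℝ] M6 :=
  endTensor ∘ₗ LinearMap.coprod (sharp ∘ₗ su3.subtype)
    (LinearMap.llcomp ℝ E6 E6 E6 J ∘ₗ sharp ∘ₗ su3.subtype)

theorem su3ToTensor_apply (p : su3 × su3) :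
    su3ToTensor p = endTensor (sharp p.1.1 + J ∘ₗ sharp p.2.1) := rfl

theorem su3ToTensor_mem_W2 (p : su3 × su3) : su3ToTensor p ∈ W2 := by
  obtain ⟨M, hM, hM0⟩ := exists_matEnd_sharp p.1.2
  obtain ⟨N, hN, hN0⟩ := exists_matEnd_sharp p.2.2
  rw [su3ToTensor_apply, ← hM, ← hN, ← matEnd_I_smul, ← map_add]
  exact endTensor_matEnd_mem_W2 (by rw [Matrix.trace_add, Matrix.trace_smul, hM0, hN0, smul_zero,
    add_zero])

theorem su3ToTensor_injective : Function.Injective su3ToTensor := by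
  rw [injective_iff_map_eq_zero]
  rintro ⟨⟨ω, hω⟩, ⟨η, hη⟩⟩ h
  rw [su3ToTensor_apply, ← map_zero endTensor] at h
  have key : ∀ u v, ω ![u, v] = η ![u, J v] := fun u v => by
    have h1 := congrArg (fun x => ⟪x, v⟫_ℝ) (LinearMap.congr_fun (endTensor_injective h) u)
    simp only [LinearMap.add_apply, LinearMap.comp_apply, inner_add_left, inner_J_left,
      inner_sharp, LinearMap.zero_apply, inner_zero_left] at h1
    linarith
  have hω0 : ∀ u v, ω ![u, v] = 0 := fun u v => by
    have h1 := key v u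
    rw [form_two_swap η, su3_J hη, neg_neg, ← key, form_two_swap] at h1
    linarith
  have hη0 : ∀ u v, η ![u, v] = 0 := fun u v => by
    have h1 := key u (J v)
    rw [hω0, J_J, form_two_neg1] at h1
    linarith
  obtain rfl : ω = 0 := form_two_ext hω0
  obtain rfl : η = 0 := form_two_ext hη0
  rfl

theorem exists_su3ToTensor_eq {x : E6 ⊗[ℝ] M6} (h : x ∈ W2) : ∃ p, su3ToTensor p = x := by
  obtain ⟨M, hM, rfl⟩ := exists_matrix_of_mem_W2 h
  refine ⟨(⟨_, skewForm_matEnd_mem_su3 hM⟩, ⟨_, skewForm_matEnd_mem_su3 (M := -Complex.I • M)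
    (by rw [Matrix.trace_smul, hM, smul_zero])⟩), ?_⟩
  rw [su3ToTensor_apply, sharp_skewForm_add]

/-! ### Representations of `SU(3)` -/

section Equivalences

variable {F G V W : Type} [Field F] [Group G] [AddCommMonoid V] [Module F V]
  [AddCommMonoid W] [Module F W] {ρ : Representation F G V} {σ : Representation F G W}

/-- A bijective intertwining map is an isomorphism of representations. -/
def equivOfBijective (f : V →ₗ[F] W) (hf : Function.Bijective f)
    (h : ∀ g v, f (ρ g v) = σ g (f v)) : ρ.Equiv σ :=
  Representation.Equiv.mk (LinearEquiv.ofBijective f hf) fun g => LinearMap.ext (h g)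

variable {V₁ V₂ V₃ V₄ V' : Type} [AddCommMonoid V₁] [Module F V₁] [AddCommMonoid V₂] [Module F V₂]
  [AddCommMonoid V₃] [Module F V₃] [AddCommMonoid V₄] [Module F V₄] [AddCommMonoid V'] [Module F V']
  {ρ₁ : Representation F G V₁} {ρ₂ : Representation F G V₂} {ρ₃ : Representation F G V₃}
  {ρ₄ : Representation F G V₄} {σ' : Representation F G V'}

/-- A representation which is a direct sum of the images of four intertwining maps. -/
def equivOfSum (f₁ : V₁ →ₗ[F] V') (f₂ : V₂ →ₗ[F] V') (f₃ : V₃ →ₗ[F] V') (f₄ : V₄ →ₗ[F] V')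
    (h₁ : ∀ g v, f₁ (ρ₁ g v) = σ' g (f₁ v)) (h₂ : ∀ g v, f₂ (ρ₂ g v) = σ' g (f₂ v))
    (h₃ : ∀ g v, f₃ (ρ₃ g v) = σ' g (f₃ v)) (h₄ : ∀ g v, f₄ (ρ₄ g v) = σ' g (f₄ v))
    (hinj : ∀ a b c d a' b' c' d', f₁ a + f₂ b + f₃ c + f₄ d = f₁ a' + f₂ b' + f₃ c' + f₄ d' →
      a = a' ∧ b = b' ∧ c = c' ∧ d = d')
    (hsurj : ∀ x, ∃ a b c d, f₁ a + f₂ b + f₃ c + f₄ d = x) :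
    (ρ₁.prod (ρ₂.prod (ρ₃.prod ρ₄))).Equiv σ' :=
  have hf : ∀ v, f₁.coprod (f₂.coprod (f₃.coprod f₄)) v =
      f₁ v.1 + f₂ v.2.1 + f₃ v.2.2.1 + f₄ v.2.2.2 := fun v => by
    rw [add_assoc, add_assoc]
    rfl
  equivOfBijective (f₁.coprod (f₂.coprod (f₃.coprod f₄)))
    ⟨fun v w hv => by
      obtain ⟨a, b, c, d⟩ := v
      obtain ⟨a', b', c', d'⟩ := w
      rw [hf, hf] at hv
      obtain ⟨rfl, rfl, rfl, rfl⟩ := hinj _ _ _ _ _ _ _ _ hv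
      rfl, fun x => by
      obtain ⟨a, b, c, d, h⟩ := hsurj x
      exact ⟨(a, b, c, d), (hf _).trans h⟩⟩
    fun g v => by
      rw [hf, hf, map_add, map_add, map_add, ← h₁, ← h₂, ← h₃, ← h₄]
      rfl

end Equivalences

/-- `su(3)` as a representation of `SU(3)`. -/
def su3Rep : Subrepresentation (resSU3 (formRep 2)) where
  toSubmodule := su3
  apply_mem_toSubmodule A _ h := formRep_mem_su3 A.1 h

/-- The image under `Θ` of an invariant subspace, as a representation of `SU(3)`. -/
def ΘRep (W : Submodule ℝ (Form 3)) (hW : ∀ (A : U3), ∀ T ∈ W, formRep 3 A T ∈ W) :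
    Subrepresentation (resSU3 tensorRep) where
  toSubmodule := W.map Θ
  apply_mem_toSubmodule A x h := by
    obtain ⟨T, hT, rfl⟩ := h
    exact ⟨_, hW A.1 T hT, Θ_formRep A.1 T⟩

/-- `𝒲₁` as a representation of `SU(3)`. -/
def W1Rep : Subrepresentation (resSU3 tensorRep) := ΘRep Λ2 fun A _ h => formRep_mem_Λ2 A h

/-- `𝒲₂` as a representation of `SU(3)`. -/
def W2Rep : Subrepresentation (resSU3 tensorRep) where
  toSubmodule := W2
  apply_mem_toSubmodule A _ h := tensorRep_mem_W2 A.1 h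

/-- `𝒲₃` as a representation of `SU(3)`. -/
def W3Rep : Subrepresentation (resSU3 tensorRep) := ΘRep Λ12 fun A _ h => formRep_mem_Λ12 A h

/-- `𝒲₄` as a representation of `SU(3)`. -/
def W4Rep : Subrepresentation (resSU3 tensorRep) := ΘRep Λ6 fun A _ h => formRep_mem_Λ6 A h

theorem formRep_of_mem_Λ2 (A : SU3) {T : Form 3} (h : T ∈ Λ2) : formRep 3 A.1 T = T := by
  obtain ⟨c, rfl⟩ := mem_Λ2_iff_psi.1 h
  exact formRep_psi A c

/-- The map `(a, b) ↦ Θ(Re((a + i b) dz₁ ∧ dz₂ ∧ dz₃))`. -/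
def psiTensor : (Fin 2 → ℝ) →ₗ[ℝ] E6 ⊗[ℝ] M6 :=
  Θ ∘ₗ psi ∘ₗ Complex.basisOneI.equivFun.symm

theorem psiTensor_mem_W1 (a : Fin 2 → ℝ) : psiTensor a ∈ W1 := ⟨_, psi_mem_Λ2 _, rfl⟩

theorem psiTensor_injective : Function.Injective psiTensor :=
  Θ_injective.comp (psi_injective.comp Complex.basisOneI.equivFun.symm.injective)

theorem exists_psiTensor_eq {x : E6 ⊗[ℝ] M6} (h : x ∈ W1) : ∃ a, psiTensor a = x := by
  obtain ⟨T, hT, rfl⟩ := h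
  obtain ⟨c, rfl⟩ := mem_Λ2_iff_psi.1 hT
  exact ⟨Complex.basisOneI.equivFun c,
    congrArg (fun c => Θ (psi c)) (Complex.basisOneI.equivFun.symm_apply_apply c)⟩

theorem tensorRep_psiTensor (A : SU3) (a : Fin 2 → ℝ) :
    tensorRep A.1 (psiTensor a) = psiTensor a :=
  (Θ_formRep A.1 _).symm.trans (congrArg Θ (formRep_psi A _))

theorem tensorRep_su3ToTensor (A : SU3) (p : su3 × su3) : tensorRep A.1 (su3ToTensor p) =
    su3ToTensor ((su3Rep.toRepresentation.prod su3Rep.toRepresentation) A p) := by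
  rw [su3ToTensor_apply, tensorRep_endTensor]
  change _ = endTensor (sharp (formRep 2 A.1 p.1.1) + J ∘ₗ sharp (formRep 2 A.1 p.2.1))
  rw [sharp_formRep, sharp_formRep, ← conjEnd_J_comp]
  congr 1
  ext1 u
  exact A.1.1.map_add _ _

/-- As a representation of `SU(3)`, `𝒲₁` is trivial. -/
def trivialEquivW1 :
    (Representation.trivial ℝ SU3 (Fin 2 → ℝ)).Equiv W1Rep.toRepresentation :=
  equivOfBijective (psiTensor.codRestrict W1 psiTensor_mem_W1)
    ⟨fun _ _ h => psiTensor_injective (congrArg Subtype.val h), fun x =>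
      (exists_psiTensor_eq x.2).imp fun _ h => Subtype.ext h⟩
    fun A a => Subtype.ext (tensorRep_psiTensor A a).symm

/-- As a representation of `SU(3)`, `𝒲₂` is the sum of two copies of `su(3)`. -/
def su3EquivW2 : (su3Rep.toRepresentation.prod su3Rep.toRepresentation).Equiv
    W2Rep.toRepresentation :=
  equivOfBijective (su3ToTensor.codRestrict W2 su3ToTensor_mem_W2)
    ⟨fun _ _ h => su3ToTensor_injective (congrArg Subtype.val h), fun x =>
      (exists_su3ToTensor_eq x.2).imp fun _ h => Subtype.ext h⟩
    fun A p => Subtype.ext (tensorRep_su3ToTensor A p).symm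

theorem W_sum_inj {a b c d a' b' c' d' : E6 ⊗[ℝ] M6} (ha : a ∈ W1) (hb : b ∈ W2) (hc : c ∈ W3)
    (hd : d ∈ W4) (ha' : a' ∈ W1) (hb' : b' ∈ W2) (hc' : c' ∈ W3) (hd' : d' ∈ W4)
    (h : a + b + c + d = a' + b' + c' + d') : a = a' ∧ b = b' ∧ c = c' ∧ d = d' := by
  have h1 := W_sum_eq_zero (W1.sub_mem ha ha') (W2.sub_mem hb hb') (W3.sub_mem hc hc')
    (W4.sub_mem hd hd') (by rw [← sub_eq_zero] at h; rw [← h]; abel)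
  simpa only [sub_eq_zero] using h1

theorem exists_sum_eq (x : E6 ⊗[ℝ] M6) : ∃ (a : Fin 2 → ℝ) (p : su3 × su3) (c : W3) (d : W4),
    psiTensor a + su3ToTensor p + c.1 + d.1 = x := by
  obtain ⟨a, ha, b, hb, c, hc, d, hd, h⟩ := exists_W_decomposition x
  obtain ⟨a', ha'⟩ := exists_psiTensor_eq ha
  obtain ⟨p, hp⟩ := exists_su3ToTensor_eq hb
  exact ⟨a', p, ⟨c, hc⟩, ⟨d, hd⟩, by rw [ha', hp]; exact h⟩

/-- The decomposition of `ℝ⁶ ⊗ 𝔪` as a representation of `SU(3)`. -/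
def decompositionEquiv : ((Representation.trivial ℝ SU3 (Fin 2 → ℝ)).prod
    ((su3Rep.toRepresentation.prod su3Rep.toRepresentation).prod
      (W3Rep.toRepresentation.prod W4Rep.toRepresentation))).Equiv (resSU3 tensorRep) := by
  refine equivOfSum psiTensor su3ToTensor W3Rep.toSubmodule.subtype W4Rep.toSubmodule.subtype
    ?_ ?_ ?_ ?_ ?_ ?_
  · exact fun A a => (tensorRep_psiTensor A a).symm
  · exact fun A p => (tensorRep_su3ToTensor A p).symm
  · exact fun _ _ => rfl
  · exact fun _ _ => rfl
  · intro a p c d a' p' c' d' h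
    obtain ⟨h1, h2, h3, h4⟩ := W_sum_inj (psiTensor_mem_W1 a) (su3ToTensor_mem_W2 p) c.2 d.2
      (psiTensor_mem_W1 a') (su3ToTensor_mem_W2 p') c'.2 d'.2 h
    exact ⟨psiTensor_injective h1, su3ToTensor_injective h2, Subtype.ext h3, Subtype.ext h4⟩
  · exact exists_sum_eq

/-! ### The main theorem -/

theorem isIrreducibleOn_Λ6 : IsIrreducibleOn (formRep 3) Λ6 :=
  isIrreducibleOn_SU3_Λ6.of_resSU3 fun A _ h => formRep_mem_Λ6 A h

theorem isIrreducibleOn_Λ12 : IsIrreducibleOn (formRep 3) Λ12 :=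
  isIrreducibleOn_SU3_Λ12.of_resSU3 fun A _ h => formRep_mem_Λ12 A h

end AlmostHermitian

end

theorem mainTheorem6 :
    -- The decomposition of the space of 3-forms
    DirectSum.IsInternal ![Λ2, Λ6, Λ12] ∧
    (Module.finrank ℝ Λ2 = 2 ∧ Module.finrank ℝ Λ6 = 6 ∧ Module.finrank ℝ Λ12 = 12) ∧
    (IsIrreducibleOn (formRep 3) Λ2 ∧ IsIrreducibleOn (formRep 3) Λ6 ∧
      IsIrreducibleOn (formRep 3) Λ12) ∧
    -- The components are eigenspaces
    (∀ T, T ∈ Λ2 ↔ formJ 3 T = hodge T ∧ τ T = (3 : ℝ) • hodge T) ∧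
    (∀ T, T ∈ Λ6 ↔ formJ 3 T = -hodge T) ∧
    (∀ T, T ∈ Λ6 → τ T = hodge T) ∧
    (∀ T, T ∈ Λ12 ↔ formJ 3 T = hodge T ∧ τ T = -hodge T) ∧
    -- Restriction to SU(3)
    (IsIrreducibleOn (resSU3 (formRep 3)) Λ6 ∧ IsIrreducibleOn (resSU3 (formRep 3)) Λ12 ∧
      ∀ (A : SU3), ∀ T ∈ Λ2, resSU3 (formRep 3) A T = T) ∧
    -- The components as complex representations
    (IsComplexIrreducibleOn complexFormRep Λ2 1 ∧ IsComplexIrreducibleOn complexFormRep Λ6 3 ∧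
      IsComplexIrreducibleOn complexFormRep Λ12 6) ∧
    (IsComplexIrreducibleOn (resSU3 complexFormRep) Λ2 1 ∧
      IsComplexIrreducibleOn (resSU3 complexFormRep) Λ6 3 ∧
      IsComplexIrreducibleOn (resSU3 complexFormRep) Λ12 6) ∧
    -- The decomposition of ℝ⁶ ⊗ 𝔪 under U(3)
    DirectSum.IsInternal ![W1, W2, W3, W4] ∧
    (Module.finrank ℝ W1 = 2 ∧ Module.finrank ℝ W2 = 16 ∧
      Module.finrank ℝ W3 = 12 ∧ Module.finrank ℝ W4 = 6) ∧
    (IsIrreducibleOn tensorRep W1 ∧ IsIrreducibleOn tensorRep W2 ∧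
      IsIrreducibleOn tensorRep W3 ∧ IsIrreducibleOn tensorRep W4) ∧
    -- The decomposition of ℝ⁶ ⊗ 𝔪 under SU(3)
    (∃ (s : Subrepresentation (resSU3 (formRep 2)))
        (S1 S2 S3 S4 : Subrepresentation (resSU3 tensorRep)),
      s.toSubmodule = su3 ∧ S1.toSubmodule = W1 ∧ S2.toSubmodule = W2 ∧
      S3.toSubmodule = W3 ∧ S4.toSubmodule = W4 ∧
      Nonempty (S1.toRepresentation.Equiv (Representation.trivial ℝ SU3 (Fin 2 → ℝ))) ∧
      Nonempty (S2.toRepresentation.Equiv (s.toRepresentation.prod s.toRepresentation)) ∧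
      Nonempty ((resSU3 tensorRep).Equiv
        ((Representation.trivial ℝ SU3 (Fin 2 → ℝ)).prod
          ((s.toRepresentation.prod s.toRepresentation).prod
            (S3.toRepresentation.prod S4.toRepresentation))))) := by
  have hC : ∀ (A : U3) (T : Form 3),
      complexFormRep A (toComplexForm3 T) = toComplexForm3 (formRep 3 A T) := fun _ _ => rfl
  have hCS : ∀ (A : SU3) (T : Form 3), resSU3 complexFormRep A (toComplexForm3 T) =
      toComplexForm3 (resSU3 (formRep 3) A T) := fun _ _ => rfl
  refine ⟨isInternal_Λ, ⟨finrank_Λ2, finrank_Λ6, finrank_Λ12⟩,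
    ⟨isIrreducibleOn_Λ2, isIrreducibleOn_Λ6, isIrreducibleOn_Λ12⟩,
    mem_Λ2_iff_hodge, mem_Λ6_iff_hodge, fun _ => τ_eq_hodge_of_mem_Λ6,
    mem_Λ12_iff_hodge,
    ⟨isIrreducibleOn_SU3_Λ6, isIrreducibleOn_SU3_Λ12, fun A _ h => formRep_of_mem_Λ2 A h⟩,
    ⟨?_, ?_, ?_⟩, ⟨?_, ?_, ?_⟩, isInternal_W,
    ⟨(finrank_map_Θ Λ2).trans finrank_Λ2, finrank_W2, (finrank_map_Θ Λ12).trans finrank_Λ12,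
      (finrank_map_Θ Λ6).trans finrank_Λ6⟩,
    ⟨isIrreducibleOn_map_Θ isIrreducibleOn_Λ2, isIrreducibleOn_W2,
      isIrreducibleOn_map_Θ isIrreducibleOn_Λ12, isIrreducibleOn_map_Θ isIrreducibleOn_Λ6⟩,
    su3Rep, W1Rep, W2Rep, W3Rep, W4Rep, rfl, rfl, rfl, rfl, rfl,
    ⟨trivialEquivW1.symm⟩, ⟨su3EquivW2.symm⟩, ⟨decompositionEquiv.symm⟩⟩
  · exact isComplexIrreducibleOn_of hC finrank_Λ2 one_ne_zero (fun _ h => formJ_mem_Λ2 h)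
      (fun A _ h => formRep_mem_Λ2 A h) fun S hS hJ _ h0 => eq_Λ2_of_formJ_closed hS hJ h0
  · exact isComplexIrreducibleOn_of hC finrank_Λ6 three_ne_zero (fun _ h => formJ_mem_Λ6 h)
      (fun A _ h => formRep_mem_Λ6 A h) fun S hS _ hinv h0 =>
        (isIrreducibleOn_iff.1 isIrreducibleOn_Λ6).2.2 S hS hinv h0
  · exact isComplexIrreducibleOn_of hC finrank_Λ12 (by decide) (fun _ h => formJ_mem_Λ12 h)
      (fun A _ h => formRep_mem_Λ12 A h) fun S hS _ hinv h0 =>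
        (isIrreducibleOn_iff.1 isIrreducibleOn_Λ12).2.2 S hS hinv h0
  · exact isComplexIrreducibleOn_of hCS finrank_Λ2 one_ne_zero (fun _ h => formJ_mem_Λ2 h)
      (fun A _ h => formRep_mem_Λ2 A.1 h) fun S hS hJ _ h0 => eq_Λ2_of_formJ_closed hS hJ h0
  · exact isComplexIrreducibleOn_of hCS finrank_Λ6 three_ne_zero (fun _ h => formJ_mem_Λ6 h)
      (fun A _ h => formRep_mem_Λ6 A.1 h) fun S hS _ hinv h0 =>
        (isIrreducibleOn_iff.1 isIrreducibleOn_SU3_Λ6).2.2 S hS hinv h0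
  · exact isComplexIrreducibleOn_of hCS finrank_Λ12 (by decide) (fun _ h => formJ_mem_Λ12 h)
      (fun A _ h => formRep_mem_Λ12 A.1 h) fun S hS _ hinv h0 =>
        (isIrreducibleOn_iff.1 isIrreducibleOn_SU3_Λ12).2.2 S hS hinv h0
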